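/- Let $k$ be a commutative ring, $A$ a $k$-algebra with unit, $\mathcal C$ an $A$-coring, and $\mathcal M^{\mathcal C}$ the category of right $\mathcal C$-comodules. Let $(I,\le)$ be a non-empty directed partially ordered set and $\underline M^s$ a split direct system in $\mathcal M^{\mathcal C}$ indexed by $I$: right $\mathcal C$-comodules $M_i$ $(i\in I)$ and, for $i\le j$, $\mathcal C$-colinear maps $\mu_{ji}:M_i\to M_j$ and $\nu_{ij}:M_j\to M_i$ with $\nu_{ij}\circ\mu_{ji}=\mathrm{id}_{M_i}$, $\mu_{ii}=\nu_{ii}=\mathrm{id}_{M_i}$, $\mu_{lj}\circ\mu_{ji}=\mu_{li}$ and $\nu_{ij}\circ\nu_{jl}=\nu_{il}$ for $i\le j\le l$. Assume that every $M_i$ is finitely generated and projective as a right $A$-module. Let $(M,(\mu_i)_{i\in I})$ be the colimit of the $M_i$ in $\mathcal M^{\mathcal C}$ along the maps $\mu_{ji}$, and let $\nu_i:M\to M_i$ be the unique colinear maps with $\nu_i\circ\mu_i=\mathrm{id}_{M_i}$ and $\nu_i=\nu_{ij}\circ\nu_j$ for $i\le j$. Let $T^\dagger$ be the colimit of the rings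 $\mathrm{End}^{\mathcal C}(M_i)$ along the multiplicative (not necessarily unital) maps $t\mapsto\mu_{ji}\circ t\circ\nu_{ij}$, so that $T^\dagger$ is a ring with idempotent local units. It acts from the left on $M$, the class of $t\in\mathrm{End}^{\mathcal C}(M_i)$ acting as $\mu_i\circ t\circ\nu_i$, and from the right, by $(\varphi t)(m)=\varphi(tm)$, on $$M^\dagger=\{\varphi\in\mathrm{Hom}_A(M,A)\mid \varphi=\varphi\circ\mu_i\circ\nu_i\text{ for some }i\in I\}.$$ Let $\mathcal G=M^\dagger\otimes_{T^\dagger}M$ be the associated comatrix $A$-coring, and assume that $\underline M^s$ is a split direct system of Galois $\mathcal C$-comodules, that is, that the canonical coring morphism $$\mathrm{can}:\mathcal G\to\mathcal C,\qquad \mathrm{can}(\varphi\otimes m)=\varphi(m_{[0]})\,m_{[1]},$$ is an isomorphism, where $m_{[0]}\otimes_A m_{[1]}$ denotes the coaction of $m$. A right $T^\dagger$-module $N$ is called firm if the multiplication map $N\otimes_{T^\dagger}T^\dagger\to N$ is an isomorphism. If $M$ is faithfully flat as a left $T^\dagger$-module (that is, $-\otimes_{T^\dagger}M$ preserves exact sequences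 of right $T^\dagger$-modules and reflects exactness of sequences of firm right $T^\dagger$-modules), then the category $\mathcal M_{T^\dagger}$ of firm right $T^\dagger$-modules and the category $\mathcal M^{\mathcal C}$ of right $\mathcal C$-comodules are equivalent. -/

import Mathlib

open CategoryTheory CategoryTheory.Limits TensorProduct MulOpposite

universe v u

/-! ### Tensor products over a possibly noncommutative, possibly non-unital `k`-algebra

`r n b = n · b` is a right action of `B` on `N` and `l b p = b · p` a left action of `B` on `P`;
`BalTensor r l` is `N ⊗_B P`, the quotient of `N ⊗_k P` by the elements `n b ⊗ p - n ⊗ b p`. -/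

section BalTensor

variable {k : Type v} [CommRing k]
  {B N P N' P' Q : Type*}
  [AddCommGroup B] [Module k B] [AddCommGroup N] [Module k N] [AddCommGroup P] [Module k P]
  [AddCommGroup N'] [Module k N'] [AddCommGroup P'] [Module k P']
  [AddCommGroup Q] [Module k Q]

def balancedRel (r : N →ₗ[k] B →ₗ[k] N) (l : B →ₗ[k] P →ₗ[k] P) : Submodule k (N ⊗[k] P) :=
  Submodule.span k {x | ∃ n b p, x = (r n b) ⊗ₜ[k] p - n ⊗ₜ[k] (l b p)}

def BalTensor (r : N →ₗ[k] B →ₗ[k] N) (l : B →ₗ[k] P →ₗ[k] P) : Type _ :=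
  (N ⊗[k] P) ⧸ balancedRel r l

namespace BalTensor

variable {r : N →ₗ[k] B →ₗ[k] N} {l : B →ₗ[k] P →ₗ[k] P}
  {r' : N' →ₗ[k] B →ₗ[k] N'} {l' : B →ₗ[k] P' →ₗ[k] P'}

instance : AddCommGroup (BalTensor r l) :=
  inferInstanceAs (AddCommGroup ((N ⊗[k] P) ⧸ balancedRel r l))

instance : Module k (BalTensor r l) :=
  inferInstanceAs (Module k ((N ⊗[k] P) ⧸ balancedRel r l))

/-- `tmul r l n p` is the pure tensor `n ⊗_B p`. -/
def tmul (r : N →ₗ[k] B →ₗ[k] N) (l : B →ₗ[k] P →ₗ[k] P) : N →ₗ[k] P →ₗ[k] BalTensor r l :=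
  (TensorProduct.mk k N P).compr₂ (balancedRel r l).mkQ

theorem tmul_balanced (n : N) (b : B) (p : P) : tmul r l (r n b) p = tmul r l n (l b p) := by
  refine (Submodule.Quotient.eq (balancedRel r l)).2 (Submodule.subset_span ⟨n, b, p, rfl⟩)

theorem balancedRel_le (f : N →ₗ[k] P →ₗ[k] Q) (h : ∀ n b p, f (r n b) p = f n (l b p)) :
    balancedRel r l ≤ LinearMap.ker (TensorProduct.lift f) := by
  refine Submodule.span_le.2 ?_
  rintro _ ⟨n, b, p, rfl⟩
  simp [h]

/-- A `k`-bilinear balanced map on `N × P` induces a linear map on `N ⊗_B P`. -/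
def lift (f : N →ₗ[k] P →ₗ[k] Q) (h : ∀ n b p, f (r n b) p = f n (l b p)) :
    BalTensor r l →ₗ[k] Q :=
  (balancedRel r l).liftQ (TensorProduct.lift f) (balancedRel_le f h)

@[simp] theorem lift_tmul (f : N →ₗ[k] P →ₗ[k] Q) (h : ∀ n b p, f (r n b) p = f n (l b p))
    (n : N) (p : P) : lift f h (tmul r l n p) = f n p := by
  refine ((balancedRel r l).liftQ_apply (TensorProduct.lift f) (n ⊗ₜ[k] p)).trans ?_
  exact TensorProduct.lift.tmul n p

theorem hom_ext {f g : BalTensor r l →ₗ[k] Q}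
    (h : ∀ n p, f (tmul r l n p) = g (tmul r l n p)) : f = g :=
  Submodule.linearMap_qext _ (TensorProduct.ext' h)

@[elab_as_elim]
theorem induction_on {motive : BalTensor r l → Prop} (x : BalTensor r l) (zero : motive 0)
    (tmul : ∀ n p, motive (tmul r l n p)) (add : ∀ x y, motive x → motive y → motive (x + y)) :
    motive x := by
  obtain ⟨x, rfl⟩ := (balancedRel r l).mkQ_surjective x
  induction x with
  | zero => exact (map_zero (balancedRel r l).mkQ).symm ▸ zero
  | tmul n p => exact tmul n p
  | add x y hx hy => exact (map_add (balancedRel r l).mkQ x y).symm ▸ add _ _ hx hy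

/-- `f ⊗_B g`, for maps `f` and `g` that commute with the actions of `B`. -/
def map (f : N →ₗ[k] N') (g : P →ₗ[k] P') (hf : ∀ n b, f (r n b) = r' (f n) b)
    (hg : ∀ b p, g (l b p) = l' b (g p)) : BalTensor r l →ₗ[k] BalTensor r' l' :=
  lift ((tmul r' l').compl₁₂ f g) (fun n b p => by simp [hf, hg, tmul_balanced])

@[simp] theorem map_tmul (f : N →ₗ[k] N') (g : P →ₗ[k] P') (hf : ∀ n b, f (r n b) = r' (f n) b)
    (hg : ∀ b p, g (l b p) = l' b (g p)) (n : N) (p : P) :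
    map f g hf hg (tmul r l n p) = tmul r' l' (f n) (g p) := by
  simp [map]

end BalTensor

end BalTensor

/-! ### Tensor products over a unital `k`-algebra `A`

Right `A`-modules are modules over `Aᵐᵒᵖ`; `op a • m` is `m · a`. -/

section TensorA

set_option linter.unusedSectionVars false

variable (k : Type v) [CommRing k] (A : Type u) [Ring A] [Algebra k A]

def leftAct (M : Type*) [AddCommGroup M] [Module k M] [Module A M] [IsScalarTower k A M] :
    A →ₗ[k] M →ₗ[k] M :=
  LinearMap.mk₂ k (fun a m => a • m) (fun _ _ _ => add_smul _ _ _) (fun _ _ _ => smul_assoc _ _ _)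
    (fun _ _ _ => smul_add _ _ _) (fun c a m => smul_comm a c m)

def rightAct (M : Type*) [AddCommGroup M] [Module k M] [Module Aᵐᵒᵖ M] [IsScalarTower k Aᵐᵒᵖ M] :
    M →ₗ[k] A →ₗ[k] M :=
  LinearMap.mk₂ k (fun m a => op a • m) (fun _ _ _ => smul_add _ _ _)
    (fun c m a => smul_comm (op a) c m) (fun _ _ _ => by rw [MulOpposite.op_add, add_smul])
    (fun c m a => by rw [MulOpposite.op_smul, smul_assoc])

/-- `M ⊗_A N` for a right `A`-module `M` and a left `A`-module `N`. -/
abbrev TensorA (M N : Type*) [AddCommGroup M] [Module k M] [Module Aᵐᵒᵖ M] [IsScalarTower k Aᵐᵒᵖ M]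
    [AddCommGroup N] [Module k N] [Module A N] [IsScalarTower k A N] : Type _ :=
  BalTensor (rightAct k A M) (leftAct k A N)

namespace TensorA

section

variable {M N M' N' : Type*}
  [AddCommGroup M] [Module k M] [Module Aᵐᵒᵖ M] [IsScalarTower k Aᵐᵒᵖ M]
  [AddCommGroup N] [Module k N] [Module A N] [IsScalarTower k A N]
  [AddCommGroup M'] [Module k M'] [Module Aᵐᵒᵖ M'] [IsScalarTower k Aᵐᵒᵖ M']
  [AddCommGroup N'] [Module k N'] [Module A N'] [IsScalarTower k A N']

/-- The pure tensor `m ⊗_A n`, bilinear in `m` and `n`. -/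
def tmul : M →ₗ[k] N →ₗ[k] TensorA k A M N := BalTensor.tmul _ _

theorem smul_tmul (m : M) (a : A) (n : N) : tmul k A (op a • m) n = tmul k A m (a • n) :=
  BalTensor.tmul_balanced (r := rightAct k A M) (l := leftAct k A N) m a n

def lift {Q : Type*} [AddCommGroup Q] [Module k Q] (f : M →ₗ[k] N →ₗ[k] Q)
    (h : ∀ m (a : A) n, f (op a • m) n = f m (a • n)) : TensorA k A M N →ₗ[k] Q :=
  BalTensor.lift f h

@[simp] theorem lift_tmul {Q : Type*} [AddCommGroup Q] [Module k Q] (f : M →ₗ[k] N →ₗ[k] Q)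
    (h : ∀ m (a : A) n, f (op a • m) n = f m (a • n)) (m : M) (n : N) :
    lift k A f h (tmul k A m n) = f m n :=
  BalTensor.lift_tmul _ _ _ _

variable {k A} in
theorem hom_ext {Q : Type*} [AddCommGroup Q] [Module k Q] {f g : TensorA k A M N →ₗ[k] Q}
    (h : ∀ m n, f (tmul k A m n) = g (tmul k A m n)) : f = g :=
  BalTensor.hom_ext h

variable {k A} in
@[elab_as_elim]
theorem induction_on {motive : TensorA k A M N → Prop} (x : TensorA k A M N) (zero : motive 0)
    (tmul : ∀ m n, motive (tmul k A m n)) (add : ∀ x y, motive x → motive y → motive (x + y)) :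
    motive x :=
  BalTensor.induction_on x zero tmul add

/-- `f ⊗_A g` for a right `A`-linear map `f` and a left `A`-linear map `g`. -/
def map (f : M →ₗ[Aᵐᵒᵖ] M') (g : N →ₗ[A] N') : TensorA k A M N →ₗ[k] TensorA k A M' N' :=
  BalTensor.map (f.restrictScalars k) (g.restrictScalars k)
    (fun m a => f.map_smul (op a) m) (fun a n => g.map_smul a n)

@[simp] theorem map_tmul (f : M →ₗ[Aᵐᵒᵖ] M') (g : N →ₗ[A] N') (m : M) (n : N) :
    map k A f g (tmul k A m n) = tmul k A (f m) (g n) :=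
  BalTensor.map_tmul _ _ _ _ _ _

end

section LeftModule

/-! If `M` is an `A`-bimodule, then `M ⊗_A N` is a left `A`-module. -/

variable {M N : Type*}
  [AddCommGroup M] [Module k M] [Module A M] [Module Aᵐᵒᵖ M] [IsScalarTower k A M]
  [IsScalarTower k Aᵐᵒᵖ M] [SMulCommClass A Aᵐᵒᵖ M]
  [AddCommGroup N] [Module k N] [Module A N] [IsScalarTower k A N]

/-- Left multiplication by `a` on an `A`-bimodule, as a right `A`-linear map. -/
def leftMul (M : Type*) [AddCommGroup M] [Module A M] [Module Aᵐᵒᵖ M] [SMulCommClass A Aᵐᵒᵖ M]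
    (a : A) : M →ₗ[Aᵐᵒᵖ] M where
  toFun m := a • m
  map_add' := smul_add a
  map_smul' b m := smul_comm a b m

instance : SMul A (TensorA k A M N) := ⟨fun a => map k A (leftMul A M a) LinearMap.id⟩

@[simp] theorem left_smul_tmul (a : A) (m : M) (n : N) :
    a • tmul k A m n = tmul k A (a • m) n :=
  map_tmul k A (leftMul A M a) LinearMap.id m n

@[simp] theorem left_smul_zero (a : A) : a • (0 : TensorA k A M N) = 0 :=
  (map k A (leftMul A M a) LinearMap.id).map_zero

@[simp] theorem left_smul_add (a : A) (x y : TensorA k A M N) : a • (x + y) = a • x + a • y :=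
  (map k A (leftMul A M a) LinearMap.id).map_add x y

instance : Module A (TensorA k A M N) where
  smul_zero a := left_smul_zero k A a
  smul_add a := left_smul_add k A a
  one_smul x := induction_on x (by simp) (by simp) (by simp +contextual)
  mul_smul a b x := induction_on x (by simp) (by simp [mul_smul]) (by simp +contextual)
  add_smul a b x := induction_on x (by simp) (by simp [add_smul])
    (fun x y hx hy => by simp only [left_smul_add, hx, hy]; abel)
  zero_smul x := induction_on x (by simp) (by simp) (by simp +contextual)

instance : IsScalarTower k A (TensorA k A M N) where
  smul_assoc c a x := induction_on x (by simp) (by simp) (by simp +contextual)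

end LeftModule

section RightModule

/-! If `N` is an `A`-bimodule, then `M ⊗_A N` is a right `A`-module. -/

variable {M N : Type*}
  [AddCommGroup M] [Module k M] [Module Aᵐᵒᵖ M] [IsScalarTower k Aᵐᵒᵖ M]
  [AddCommGroup N] [Module k N] [Module A N] [Module Aᵐᵒᵖ N] [IsScalarTower k A N]
  [IsScalarTower k Aᵐᵒᵖ N] [SMulCommClass A Aᵐᵒᵖ N]

/-- Right multiplication by `a` on an `A`-bimodule, as a left `A`-linear map. -/
def rightMul (N : Type*) [AddCommGroup N] [Module A N] [Module Aᵐᵒᵖ N] [SMulCommClass A Aᵐᵒᵖ N]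
    (a : Aᵐᵒᵖ) : N →ₗ[A] N where
  toFun n := a • n
  map_add' := smul_add a
  map_smul' b n := (smul_comm b a n).symm

instance : SMul Aᵐᵒᵖ (TensorA k A M N) := ⟨fun a => map k A LinearMap.id (rightMul A N a)⟩

@[simp] theorem right_smul_tmul (a : Aᵐᵒᵖ) (m : M) (n : N) :
    a • tmul k A m n = tmul k A m (a • n) :=
  map_tmul k A LinearMap.id (rightMul A N a) m n

@[simp] theorem right_smul_zero (a : Aᵐᵒᵖ) : a • (0 : TensorA k A M N) = 0 :=
  (map k A LinearMap.id (rightMul A N a)).map_zero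

@[simp] theorem right_smul_add (a : Aᵐᵒᵖ) (x y : TensorA k A M N) :
    a • (x + y) = a • x + a • y :=
  (map k A LinearMap.id (rightMul A N a)).map_add x y

instance : Module Aᵐᵒᵖ (TensorA k A M N) where
  smul_zero a := right_smul_zero k A a
  smul_add a := right_smul_add k A a
  one_smul x := induction_on x (by simp) (by simp) (by simp +contextual)
  mul_smul a b x := induction_on x (by simp) (by simp [mul_smul]) (by simp +contextual)
  add_smul a b x := induction_on x (by simp) (by simp [add_smul])
    (fun x y hx hy => by simp only [right_smul_add, hx, hy]; abel)
  zero_smul x := induction_on x (by simp) (by simp) (by simp +contextual)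

instance : IsScalarTower k Aᵐᵒᵖ (TensorA k A M N) where
  smul_assoc c a x := induction_on x (by simp) (by simp) (by simp +contextual)

end RightModule

section Assoc

variable (M C D : Type*)
  [AddCommGroup M] [Module k M] [Module Aᵐᵒᵖ M] [IsScalarTower k Aᵐᵒᵖ M]
  [AddCommGroup C] [Module k C] [Module A C] [Module Aᵐᵒᵖ C] [IsScalarTower k A C]
  [IsScalarTower k Aᵐᵒᵖ C] [SMulCommClass A Aᵐᵒᵖ C]
  [AddCommGroup D] [Module k D] [Module A D] [IsScalarTower k A D]

/-- For fixed `m`, the map `c ↦ (d ↦ m ⊗ (c ⊗ d))`, linear also in `m`. -/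
def assocAux : M →ₗ[k] C →ₗ[k] D →ₗ[k] TensorA k A M (TensorA k A C D) :=
  LinearMap.mk₂ k (fun m c => (tmul k A m).comp (tmul k A c))
    (fun _ _ _ => by ext; simp) (fun _ _ _ => by ext; simp)
    (fun _ _ _ => by ext; simp) (fun _ _ _ => by ext; simp)

/-- The associativity map `(M ⊗_A C) ⊗_A D → M ⊗_A (C ⊗_A D)`, `(m ⊗ c) ⊗ d ↦ m ⊗ (c ⊗ d)`. -/
def assoc : TensorA k A (TensorA k A M C) D →ₗ[k] TensorA k A M (TensorA k A C D) :=
  lift k A (lift k A (assocAux k A M C D) (fun m a c => by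
      ext d
      simp [assocAux, smul_tmul]))
    (fun x a d => induction_on x (by simp)
      (fun m c => by simp [assocAux, smul_tmul]) (fun x y hx hy => by simp [hx, hy]))

@[simp] theorem assoc_tmul (m : M) (c : C) (d : D) :
    assoc k A M C D (tmul k A (tmul k A m c) d) = tmul k A m (tmul k A c d) := by
  simp [assoc, assocAux]

end Assoc

end TensorA

end TensorA

/-! ### Corings and their right comodules -/

section Coring

set_option linter.unusedSectionVars false

variable (k : Type v) [CommRing k] (A : Type u) [Ring A] [Algebra k A]

/-- A left `A`-linear map that is also right `A`-linear, as a right `A`-linear map. -/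
def LinearMap.asRight {A C D : Type*} [Ring A] [AddCommGroup C] [Module A C] [Module Aᵐᵒᵖ C]
    [AddCommGroup D] [Module A D] [Module Aᵐᵒᵖ D] (f : C →ₗ[A] D)
    (hf : ∀ (a : A) c, f (op a • c) = op a • f c) : C →ₗ[Aᵐᵒᵖ] D where
  toFun := f
  map_add' := f.map_add
  map_smul' a c := hf a.unop c

/-- For an `A`-bimodule `C` and a left `A`-linear `e : C → A`, the map `M ⊗_A C → M`,
`m ⊗ c ↦ m · e c`. -/
def TensorA.contractRight {M C : Type*}
    [AddCommGroup M] [Module k M] [Module Aᵐᵒᵖ M] [IsScalarTower k Aᵐᵒᵖ M]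
    [AddCommGroup C] [Module k C] [Module A C] [IsScalarTower k A C]
    (e : C →ₗ[A] A) : TensorA k A M C →ₗ[k] M :=
  TensorA.lift k A ((rightAct k A M).compl₂ (e.restrictScalars k))
    (fun m a c => by simp [rightAct, mul_smul])

/-- For a right `A`-linear `e : M → A`, the map `M ⊗_A C → C`, `m ⊗ c ↦ e m · c`. -/
def TensorA.contractLeft {M C : Type*}
    [AddCommGroup M] [Module k M] [Module Aᵐᵒᵖ M] [IsScalarTower k Aᵐᵒᵖ M]
    [AddCommGroup C] [Module k C] [Module A C] [IsScalarTower k A C]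
    (e : M →ₗ[Aᵐᵒᵖ] A) : TensorA k A M C →ₗ[k] C :=
  TensorA.lift k A ((leftAct k A C).comp (e.restrictScalars k))
    (fun m a c => by simp [leftAct, mul_smul])

section

variable {k A} {M M' C : Type*}
  [AddCommGroup M] [Module k M] [Module Aᵐᵒᵖ M] [IsScalarTower k Aᵐᵒᵖ M]
  [AddCommGroup M'] [Module k M'] [Module Aᵐᵒᵖ M'] [IsScalarTower k Aᵐᵒᵖ M']
  [AddCommGroup C] [Module k C] [Module A C] [IsScalarTower k A C]

@[simp] theorem TensorA.contractRight_tmul (e : C →ₗ[A] A) (m : M) (c : C) :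
    TensorA.contractRight k A e (TensorA.tmul k A m c) = op (e c) • m :=
  TensorA.lift_tmul _ _ _ _ _ _

@[simp] theorem TensorA.contractLeft_tmul (e : M →ₗ[Aᵐᵒᵖ] A) (m : M) (c : C) :
    TensorA.contractLeft k A e (TensorA.tmul k A m c) = e m • c :=
  TensorA.lift_tmul _ _ _ _ _ _

theorem TensorA.contractLeft_add (e e' : M →ₗ[Aᵐᵒᵖ] A) (x : TensorA k A M C) :
    TensorA.contractLeft k A (e + e') x =
      TensorA.contractLeft k A e x + TensorA.contractLeft k A e' x := by
  have : TensorA.contractLeft k A (e + e') (C := C) =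
      TensorA.contractLeft k A e + TensorA.contractLeft k A e' :=
    TensorA.hom_ext fun m c => by simp [add_smul]
  rw [this, LinearMap.add_apply]

theorem TensorA.contractLeft_smul (a : k) (e : M →ₗ[Aᵐᵒᵖ] A) (x : TensorA k A M C) :
    TensorA.contractLeft k A (a • e) x = a • TensorA.contractLeft k A e x := by
  have : TensorA.contractLeft k A (a • e) (C := C) = a • TensorA.contractLeft k A e :=
    TensorA.hom_ext fun m c => by simp
  rw [this, LinearMap.smul_apply]

theorem TensorA.contractLeft_comp (e : M' →ₗ[Aᵐᵒᵖ] A) (f : M →ₗ[Aᵐᵒᵖ] M') (x : TensorA k A M C) :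
    TensorA.contractLeft k A (e ∘ₗ f) x =
      TensorA.contractLeft k A e (TensorA.map k A f LinearMap.id x) := by
  have : TensorA.contractLeft k A (e ∘ₗ f) (C := C) =
      TensorA.contractLeft k A e ∘ₗ TensorA.map k A f LinearMap.id :=
    TensorA.hom_ext fun m c => by simp
  rw [this, LinearMap.comp_apply]

end

/-- An `A`-coring structure on an `A`-bimodule `C` (on which `k` acts centrally): bimodule maps
`comul : C → C ⊗_A C` and `counit : C → A` that are coassociative and counital. -/
class Coring (C : Type u) [AddCommGroup C] [Module k C] [Module A C] [Module Aᵐᵒᵖ C]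
    [IsScalarTower k A C] [IsScalarTower k Aᵐᵒᵖ C] [SMulCommClass A Aᵐᵒᵖ C] where
  comul : C →ₗ[A] TensorA k A C C
  comul_op_smul : ∀ (a : A) (c : C), comul (op a • c) = op a • comul c
  counit : C →ₗ[A] A
  counit_op_smul : ∀ (a : A) (c : C), counit (op a • c) = op a • counit c
  coassoc : ∀ c : C,
    TensorA.assoc k A C C C
        (TensorA.map k A (comul.asRight comul_op_smul) LinearMap.id (comul c)) =
      TensorA.map k A LinearMap.id comul (comul c)
  counit_comul : ∀ c : C, TensorA.contractLeft k A (counit.asRight counit_op_smul) (comul c) = c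
  comul_counit : ∀ c : C, TensorA.contractRight k A counit (comul c) = c

variable (C : Type u) [AddCommGroup C] [Module k C] [Module A C] [Module Aᵐᵒᵖ C]
  [IsScalarTower k A C] [IsScalarTower k Aᵐᵒᵖ C] [SMulCommClass A Aᵐᵒᵖ C] [Coring k A C]

/-- Right `C`-comodules. -/
structure Comod where
  carrier : Type u
  [addCommGroup : AddCommGroup carrier]
  [moduleBase : Module k carrier]
  [module : Module Aᵐᵒᵖ carrier]
  [isScalarTower : IsScalarTower k Aᵐᵒᵖ carrier]
  coact : carrier →ₗ[Aᵐᵒᵖ] TensorA k A carrier C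
  coassoc : ∀ m : carrier,
    TensorA.assoc k A carrier C C (TensorA.map k A coact LinearMap.id (coact m)) =
      TensorA.map k A LinearMap.id (Coring.comul (k := k) : C →ₗ[A] TensorA k A C C) (coact m)
  coact_counit : ∀ m : carrier, TensorA.contractRight k A (Coring.counit (k := k) : C →ₗ[A] A) (coact m) = m

namespace Comod

attribute [instance] addCommGroup moduleBase module isScalarTower

variable {k A C}

/-- The `C`-colinear maps `M → N`. -/
def colinearMaps (M N : Comod k A C) : Submodule k (M.carrier →ₗ[Aᵐᵒᵖ] N.carrier) where
  carrier := {f | ∀ m, N.coact (f m) = TensorA.map k A f LinearMap.id (M.coact m)}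
  add_mem' {f g} hf hg m := by
    have : TensorA.map k A (f + g) (LinearMap.id : C →ₗ[A] C) =
        TensorA.map k A f LinearMap.id + TensorA.map k A g LinearMap.id :=
      TensorA.hom_ext fun m n => by simp
    simp only [Set.mem_ofPred_eq] at hf hg
    simp [this, hf m, hg m]
  zero_mem' m := by
    have : TensorA.map k A (0 : M.carrier →ₗ[Aᵐᵒᵖ] N.carrier) (LinearMap.id : C →ₗ[A] C) = 0 :=
      TensorA.hom_ext fun m n => by simp
    simp [this]
  smul_mem' c f hf m := by
    have : TensorA.map k A (c • f) (LinearMap.id : C →ₗ[A] C) =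
        c • TensorA.map k A f LinearMap.id :=
      TensorA.hom_ext fun m n => by simp
    have h2 : N.coact (c • f m) = c • N.coact (f m) := (N.coact.restrictScalars k).map_smul c (f m)
    simp only [Set.mem_ofPred_eq] at hf
    simp [this, h2, hf m]

/-- The category of right `C`-comodules and `C`-colinear maps. -/
instance : Category (Comod k A C) where
  Hom M N := colinearMaps M N
  id M := ⟨LinearMap.id, fun m => by
    have : TensorA.map k A (LinearMap.id : M.carrier →ₗ[Aᵐᵒᵖ] M.carrier)
        (LinearMap.id : C →ₗ[A] C) = LinearMap.id := TensorA.hom_ext fun m n => by simp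
    simp [this]⟩
  comp {M N P} f g := ⟨g.1 ∘ₗ f.1, fun m => by
    have : TensorA.map k A (g.1 ∘ₗ f.1) (LinearMap.id : C →ₗ[A] C) =
        TensorA.map k A g.1 LinearMap.id ∘ₗ TensorA.map k A f.1 LinearMap.id :=
      TensorA.hom_ext fun m n => by simp
    have hf := f.2 m
    have hg := g.2 (f.1 m)
    rw [this, LinearMap.comp_apply, LinearMap.comp_apply, hg, hf]⟩

/-- The right `A`-linear map underlying a morphism of comodules. -/
def toLin {M N : Comod k A C} (f : M ⟶ N) : M.carrier →ₗ[Aᵐᵒᵖ] N.carrier := f.1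

theorem hom_ext {M N : Comod k A C} {f g : M ⟶ N} (h : ∀ m, toLin f m = toLin g m) : f = g :=
  Subtype.ext (LinearMap.ext h)

@[simp] theorem toLin_id (M : Comod k A C) : toLin (𝟙 M) = LinearMap.id := rfl

@[simp] theorem toLin_comp {M N P : Comod k A C} (f : M ⟶ N) (g : N ⟶ P) :
    toLin (f ≫ g) = toLin g ∘ₗ toLin f := rfl

theorem coact_toLin {M N : Comod k A C} (f : M ⟶ N) (m : M.carrier) :
    N.coact (toLin f m) = TensorA.map k A (toLin f) LinearMap.id (M.coact m) := f.2 m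

instance : Preadditive (Comod k A C) where
  homGroup M N := inferInstanceAs (AddCommGroup (colinearMaps M N))
  add_comp _ _ _ f g h := hom_ext fun m => h.1.map_add (f.1 m) (g.1 m)
  comp_add _ _ _ _ _ _ := rfl

instance : Linear k (Comod k A C) where
  homModule M N := inferInstanceAs (Module k (colinearMaps M N))
  smul_comp _ _ _ c f g := hom_ext fun m => (g.1.restrictScalars k).map_smul c (f.1 m)
  comp_smul _ _ _ _ _ _ := rfl

end Comod

end Coring

/-! ### Split direct systems in a category, and the colimit of the endomorphism rings -/

/-- The category with the objects of `𝒜`, in which a morphism `M ⟶ N` is a morphism `μ : M ⟶ N`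
of `𝒜` together with a left inverse `ν : N ⟶ M` of it. -/
structure SplitCat (𝒜 : Type*) where
  of : 𝒜

namespace SplitCat

@[ext]
structure Hom {𝒜 : Type*} [Category 𝒜] (M N : SplitCat 𝒜) where
  μ : M.of ⟶ N.of
  ν : N.of ⟶ M.of
  μ_ν : μ ≫ ν = 𝟙 M.of

instance (𝒜 : Type*) [Category 𝒜] : Category (SplitCat 𝒜) where
  Hom := Hom
  id M := ⟨𝟙 _, 𝟙 _, Category.comp_id _⟩
  comp f g := ⟨f.μ ≫ g.μ, g.ν ≫ f.ν, by
    rw [Category.assoc, ← Category.assoc g.μ, g.μ_ν, Category.id_comp, f.μ_ν]⟩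
  id_comp f := Hom.ext (Category.id_comp _) (Category.comp_id _)
  comp_id f := Hom.ext (Category.comp_id _) (Category.id_comp _)
  assoc f g h := Hom.ext (Category.assoc _ _ _) (Category.assoc _ _ _).symm

/-- The functor `(μ, ν) ↦ μ`. -/
def forget (𝒜 : Type*) [Category 𝒜] : SplitCat 𝒜 ⥤ 𝒜 where
  obj M := M.of
  map f := f.μ

end SplitCat

section SplitSystem

set_option linter.unusedSectionVars false

variable {𝒜 : Type*} [Category 𝒜] {I : Type u} [PartialOrder I] (S : I ⥤ SplitCat 𝒜)

namespace SplitSystem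

/-- The transition map `μ_ji : M_i ⟶ M_j`. -/
abbrev μ {i j : I} (h : i ≤ j) : (S.obj i).of ⟶ (S.obj j).of := (S.map (homOfLE h)).μ

/-- The chosen left inverse `ν_ij : M_j ⟶ M_i` of `μ_ji`. -/
abbrev ν {i j : I} (h : i ≤ j) : (S.obj j).of ⟶ (S.obj i).of := (S.map (homOfLE h)).ν

theorem μ_ν {i j : I} (h : i ≤ j) : μ S h ≫ ν S h = 𝟙 _ := (S.map (homOfLE h)).μ_ν

theorem μ_refl (i : I) : μ S (le_refl i) = 𝟙 _ := congrArg SplitCat.Hom.μ (S.map_id i)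

theorem ν_refl (i : I) : ν S (le_refl i) = 𝟙 _ := congrArg SplitCat.Hom.ν (S.map_id i)

theorem μ_trans {i j l : I} (h : i ≤ j) (h' : j ≤ l) : μ S h ≫ μ S h' = μ S (h.trans h') :=
  (congrArg SplitCat.Hom.μ (S.map_comp (homOfLE h) (homOfLE h'))).symm

theorem ν_trans {i j l : I} (h : i ≤ j) (h' : j ≤ l) : ν S h' ≫ ν S h = ν S (h.trans h') :=
  (congrArg SplitCat.Hom.ν (S.map_comp (homOfLE h) (homOfLE h'))).symm

theorem μ_ν_indep [IsDirectedOrder I] {i j l m : I} (hil : i ≤ l) (hjl : j ≤ l) (him : i ≤ m)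
    (hjm : j ≤ m) : μ S hjl ≫ ν S hil = μ S hjm ≫ ν S him := by
  have key : ∀ {l n : I} (hil : i ≤ l) (hjl : j ≤ l) (hln : l ≤ n),
      μ S hjl ≫ ν S hil = μ S (hjl.trans hln) ≫ ν S (hil.trans hln) := by
    intro l n hil hjl hln
    rw [← μ_trans S hjl hln, ← ν_trans S hil hln, Category.assoc, ← Category.assoc (μ S hln),
      μ_ν, Category.id_comp]
  obtain ⟨n, hln, hmn⟩ := exists_ge_ge l m
  rw [key hil hjl hln, key him hjm hmn]

variable [IsDirectedOrder I] {S}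
variable {c : Cocone (S ⋙ SplitCat.forget 𝒜)} (hc : IsColimit c)

/-- The cocone with vertex `M_i` and legs `M_j ⟶ M_l ⟶ M_i`, for any `l ≥ i, j`. -/
noncomputable def retractCocone (S : I ⥤ SplitCat 𝒜) (i : I) :
    Cocone (S ⋙ SplitCat.forget 𝒜) where
  pt := (S.obj i).of
  ι :=
    { app := fun j =>
        μ S (exists_ge_ge i j).choose_spec.2 ≫ ν S (exists_ge_ge i j).choose_spec.1
      naturality := fun j j' f => by
        have hf : (S ⋙ SplitCat.forget 𝒜).map f = μ S (leOfHom f) := rfl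
        dsimp only [Functor.const_obj_obj, Functor.const_obj_map]
        rw [hf]
        refine Eq.trans ?_ (Category.comp_id _).symm
        refine (Category.assoc _ _ _).symm.trans ?_
        exact (congrArg (· ≫ ν S _) (μ_trans S (leOfHom f) _)).trans (μ_ν_indep S _ _ _ _) }

/-- The left inverse `ν_i : M ⟶ M_i` of `μ_i : M_i ⟶ M` that is induced on the colimit `M` by the
`ν_ij`; it is characterized by `ν_comp` and `μ_νc` below. -/
noncomputable def νc (i : I) : c.pt ⟶ (S.obj i).of := hc.desc (retractCocone S i)

/-- The colimit map `μ_i : M_i ⟶ M`. -/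
abbrev μc (c : Cocone (S ⋙ SplitCat.forget 𝒜)) (i : I) : (S.obj i).of ⟶ c.pt := c.ι.app i

theorem μ_μc (c : Cocone (S ⋙ SplitCat.forget 𝒜)) {i j : I} (h : i ≤ j) :
    μ S h ≫ μc c j = μc c i := c.w (homOfLE h)

theorem μc_νc_of_le {i j l : I} (hi : i ≤ l) (hj : j ≤ l) :
    μc c j ≫ νc hc i = μ S hj ≫ ν S hi :=
  (hc.fac (retractCocone S i) j).trans (μ_ν_indep S _ _ _ _)

theorem μc_νc (i : I) : μc c i ≫ νc hc i = 𝟙 _ :=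
  (μc_νc_of_le hc (le_refl i) (le_refl i)).trans (μ_ν S (le_refl i))

theorem νc_ν {i j : I} (h : i ≤ j) : νc hc j ≫ ν S h = νc hc i := by
  refine hc.hom_ext fun l => ?_
  obtain ⟨n, hjn, hln⟩ := exists_ge_ge j l
  have h1 := μc_νc_of_le hc hjn hln
  have h2 := μc_νc_of_le hc (h.trans hjn) hln
  change μc c l ≫ νc hc j ≫ ν S h = μc c l ≫ νc hc i
  rw [← Category.assoc, h1, h2, Category.assoc, ν_trans]

section Linear

variable {k : Type v} [CommRing k] [Preadditive 𝒜] [Linear k 𝒜]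

variable (k S) in
/-- The transition map `End(M_i) → End(M_j)`, `t ↦ μ_ji ∘ t ∘ ν_ij`. -/
def endMap (i j : I) (h : i ≤ j) : End (S.obj i).of →ₙₐ[k] End (S.obj j).of where
  toFun t := ν S h ≫ t ≫ μ S h
  map_smul' a t := by
    change ν S h ≫ (a • t : (S.obj i).of ⟶ (S.obj i).of) ≫ μ S h = a • (ν S h ≫ t ≫ μ S h)
    rw [Linear.smul_comp, Linear.comp_smul]
  map_zero' := by
    change ν S h ≫ (0 : (S.obj i).of ⟶ (S.obj i).of) ≫ μ S h = 0
    rw [zero_comp, comp_zero]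
  map_add' s t := by
    change ν S h ≫ (s + t : (S.obj i).of ⟶ (S.obj i).of) ≫ μ S h = ν S h ≫ s ≫ μ S h + ν S h ≫ t ≫ μ S h
    rw [Preadditive.add_comp, Preadditive.comp_add]
  map_mul' s t := by
    have := μ_ν S h
    simp only [End.mul_def, Category.assoc]
    rw [← Category.assoc (μ S h) (ν S h), this, Category.id_comp]

instance : DirectedSystem (fun i => End (S.obj i).of) (fun i j h => endMap S k i j h) where
  map_self i t := by
    change ν S _ ≫ t ≫ μ S _ = t
    rw [ν_refl, μ_refl, Category.id_comp, Category.comp_id]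
  map_map l j i h h' t := by
    change ν S h' ≫ (ν S h ≫ t ≫ μ S h) ≫ μ S h' = ν S _ ≫ t ≫ μ S _
    rw [← μ_trans S h h', ← ν_trans S h h']
    simp

variable (k S) in
/-- `T† = colim End(M_i)`, the colimit of the endomorphism rings along `endMap`. -/
def ColimEnd : Type _ :=
  DirectLimit (fun i => End (S.obj i).of) (fun i j h => endMap S k i j h)

variable [Nonempty I]

noncomputable instance : NonUnitalRing (ColimEnd S k) :=
  inferInstanceAs (NonUnitalRing
    (DirectLimit (fun i => End (S.obj i).of) (fun i j h => endMap S k i j h)))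

noncomputable instance : Module k (ColimEnd S k) :=
  inferInstanceAs (Module k
    (DirectLimit (fun i => End (S.obj i).of) (fun i j h => endMap S k i j h)))

instance : IsScalarTower k (ColimEnd S k) (ColimEnd S k) :=
  inferInstanceAs (IsScalarTower k
    (DirectLimit (fun i => End (S.obj i).of) (fun i j h => endMap S k i j h))
    (DirectLimit (fun i => End (S.obj i).of) (fun i j h => endMap S k i j h)))

instance : SMulCommClass k (ColimEnd S k) (ColimEnd S k) :=
  inferInstanceAs (SMulCommClass k
    (DirectLimit (fun i => End (S.obj i).of) (fun i j h => endMap S k i j h))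
    (DirectLimit (fun i => End (S.obj i).of) (fun i j h => endMap S k i j h)))

variable (k S) in
/-- The colimit map `ρ_i : End(M_i) → T†`. -/
noncomputable def ColimEnd.of (i : I) : End (S.obj i).of →ₙₐ[k] ColimEnd S k :=
  DirectLimit.NonUnitalAlgebra.of (fun i => End (S.obj i).of) (fun i j h => endMap S k i j h) i

theorem ColimEnd.exists_of (t : ColimEnd S k) : ∃ i s, ColimEnd.of S k i s = t := by
  induction t using DirectLimit.induction with | _ i s
  exact ⟨i, s, rfl⟩

variable (k) in
/-- The map `End(M_i) → End(M)`, `t ↦ μ_i ∘ t ∘ ν_i`. -/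
noncomputable def endMapc (i : I) : End (S.obj i).of →ₙₐ[k] End c.pt where
  toFun t := νc hc i ≫ t ≫ μc c i
  map_smul' a t := by
    change νc hc i ≫ (a • t : (S.obj i).of ⟶ (S.obj i).of) ≫ μc c i = a • (νc hc i ≫ t ≫ μc c i)
    rw [Linear.smul_comp, Linear.comp_smul]
  map_zero' := by
    change νc hc i ≫ (0 : (S.obj i).of ⟶ (S.obj i).of) ≫ μc c i = 0
    rw [zero_comp, comp_zero]
  map_add' s t := by
    change νc hc i ≫ (s + t : (S.obj i).of ⟶ (S.obj i).of) ≫ μc c i =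
      νc hc i ≫ s ≫ μc c i + νc hc i ≫ t ≫ μc c i
    rw [Preadditive.add_comp, Preadditive.comp_add]
  map_mul' s t := by
    change νc hc i ≫ (t ≫ s) ≫ μc c i = (νc hc i ≫ t ≫ μc c i) ≫ νc hc i ≫ s ≫ μc c i
    have h : μc c i ≫ νc hc i ≫ s ≫ μc c i = s ≫ μc c i := by
      rw [← Category.assoc, μc_νc, Category.id_comp]
    rw [Category.assoc, Category.assoc, Category.assoc, h]

variable (k) in
/-- The homomorphism `T† → End(M)` that is `t ↦ μ_i ∘ t ∘ ν_i` on `End(M_i)`; through it, `T†`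
acts on `M`. -/
noncomputable def toEnd : ColimEnd S k →ₙₐ[k] End c.pt :=
  DirectLimit.NonUnitalAlgebra.lift (fun i => End (S.obj i).of) (fun i j h => endMap S k i j h)
    (End c.pt) (endMapc hc k) (fun i j h t => by
    change νc hc j ≫ (ν S h ≫ t ≫ μ S h) ≫ μc c j = νc hc i ≫ t ≫ μc c i
    rw [← νc_ν hc h, ← μ_μc c h]
    simp only [Category.assoc])

theorem toEnd_of (i : I) (t : End (S.obj i).of) :
    toEnd hc k (ColimEnd.of S k i t) = νc hc i ≫ t ≫ μc c i := rfl

end Linear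

end SplitSystem

end SplitSystem

/-! ### Modules over a possibly non-unital `k`-algebra `B` -/

section NonUnital

variable (k : Type v) [CommRing k] (B : Type u) [NonUnitalRing B] [Module k B]
  [IsScalarTower k B B] [SMulCommClass k B B]

/-- Right `B`-modules, not necessarily firm; `act n b` is `n · b`. -/
structure RMod where
  carrier : Type u
  [addCommGroup : AddCommGroup carrier]
  [module : Module k carrier]
  act : carrier →ₗ[k] B →ₗ[k] carrier
  act_mul : ∀ n b b', act n (b * b') = act (act n b) b'

namespace RMod

set_option linter.unusedSectionVars false

attribute [instance] addCommGroup module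

variable {k B}

@[ext]
structure Hom (N N' : RMod k B) where
  toLin : N.carrier →ₗ[k] N'.carrier
  map_act : ∀ n b, toLin (N.act n b) = N'.act (toLin n) b

/-- The category of all right `B`-modules. -/
instance : Category (RMod k B) where
  Hom := Hom
  id N := ⟨LinearMap.id, fun _ _ => rfl⟩
  comp f g := ⟨g.toLin ∘ₗ f.toLin, fun n b => by simp [f.map_act, g.map_act]⟩

/-- The underlying `k`-linear map of a morphism of right `B`-modules. -/
def toLin {N N' : RMod k B} (f : N ⟶ N') : N.carrier →ₗ[k] N'.carrier := Hom.toLin f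

theorem toLin_act {N N' : RMod k B} (f : N ⟶ N') (n : N.carrier) (b : B) :
    toLin f (N.act n b) = N'.act (toLin f n) b := Hom.map_act f n b

/-- The canonical map `N ⊗_B B → N`, `n ⊗ b ↦ n · b`. -/
def mulMap (N : RMod k B) : BalTensor N.act (LinearMap.mul k B) →ₗ[k] N.carrier :=
  BalTensor.lift N.act (fun n b b' => (N.act_mul n b b').symm)

variable (k B) in
/-- `N` is firm if the canonical map `N ⊗_B B → N` is an isomorphism. -/
def IsFirm : ObjectProperty (RMod k B) := fun N => Function.Bijective N.mulMap

/-- For a left `B`-action `l` on `P` and a morphism `f : N → N'` of right `B`-modules, the map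
`f ⊗_B P : N ⊗_B P → N' ⊗_B P`. -/
def tensorMap {P : Type u} [AddCommGroup P] [Module k P] (l : B →ₗ[k] P →ₗ[k] P)
    {N N' : RMod k B} (f : N ⟶ N') : BalTensor N.act l →ₗ[k] BalTensor N'.act l :=
  BalTensor.map (toLin f) LinearMap.id (toLin_act f) (fun _ _ => rfl)

end RMod

/-- The category of firm right `B`-modules. -/
abbrev FirmMod := (RMod.IsFirm k B).FullSubcategory

variable {k B}

/-- The left `B`-module `P`, with action `l b p = b · p`, is flat: the functor `- ⊗_B P`, defined on
all right `B`-modules, preserves exact sequences. -/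
def IsFlatAction {P : Type u} [AddCommGroup P] [Module k P] (l : B →ₗ[k] P →ₗ[k] P) : Prop :=
  ∀ ⦃N₁ N₂ N₃ : RMod k B⦄ (f : N₁ ⟶ N₂) (g : N₂ ⟶ N₃),
    Function.Exact (RMod.toLin f) (RMod.toLin g) →
      Function.Exact (RMod.tensorMap l f) (RMod.tensorMap l g)

/-- The left `B`-module `P` is faithfully flat: it is flat, and the functor `- ⊗_B P` on the firm
right `B`-modules also reflects exact sequences. (A module that is annihilated by `B` is always sent
to zero when `P` is firm, so one can only ask for this on firm modules.) -/
def IsFaithfullyFlatAction {P : Type u} [AddCommGroup P] [Module k P]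
    (l : B →ₗ[k] P →ₗ[k] P) : Prop :=
  IsFlatAction l ∧
  ∀ ⦃N₁ N₂ N₃ : RMod k B⦄, RMod.IsFirm k B N₁ → RMod.IsFirm k B N₂ → RMod.IsFirm k B N₃ →
    ∀ (f : N₁ ⟶ N₂) (g : N₂ ⟶ N₃),
      Function.Exact (RMod.tensorMap l f) (RMod.tensorMap l g) →
        Function.Exact (RMod.toLin f) (RMod.toLin g)

end NonUnital

/-! ### Split direct systems of Galois comodules -/

section Galois

set_option linter.unusedSectionVars false

open SplitSystem

variable {k : Type v} [CommRing k] {A : Type u} [Ring A] [Algebra k A]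
  {C : Type u} [AddCommGroup C] [Module k C] [Module A C] [Module Aᵐᵒᵖ C]
  [IsScalarTower k A C] [IsScalarTower k Aᵐᵒᵖ C] [SMulCommClass A Aᵐᵒᵖ C] [Coring k A C]
  {I : Type u} [PartialOrder I] [IsDirectedOrder I] [Nonempty I]
  {S : I ⥤ SplitCat (Comod k A C)}
  {M : Cocone (S ⋙ SplitCat.forget (Comod k A C))} (hM : IsColimit M)

/-- The left action of `T†` on the colimit `M`: on `End(M_i)`, `t · m = μ_i (t (ν_i m))`. -/
noncomputable def colimAct : ColimEnd S k →ₗ[k] M.pt.carrier →ₗ[k] M.pt.carrier :=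
  LinearMap.mk₂ k (fun t m => Comod.toLin (toEnd hM k t) m)
    (fun s t m => by rw [map_add]; rfl)
    (fun a t m => by rw [map_smul]; rfl)
    (fun t m m' => map_add _ m m')
    (fun a t m => ((Comod.toLin (toEnd hM k t)).restrictScalars k).map_smul a m)

/-- The idempotent `e_i = μ_i ∘ ν_i` of `M`. -/
noncomputable def idem (i : I) : M.pt.carrier →ₗ[Aᵐᵒᵖ] M.pt.carrier :=
  Comod.toLin (νc hM i ≫ μc M i)

theorem idem_comp {i j : I} (h : i ≤ j) : idem hM i ∘ₗ idem hM j = idem hM i := by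
  have : (νc hM j ≫ μc M j) ≫ (νc hM i ≫ μc M i) = νc hM i ≫ μc M i := by
    rw [← νc_ν hM h]
    simp only [Category.assoc]
    rw [← Category.assoc (μc M j), μc_νc, Category.id_comp]
  exact congrArg Comod.toLin this

/-- `M† = {φ ∈ Hom_A(M, A) | φ = φ ∘ μ_i ∘ ν_i for some i}`. -/
noncomputable def dualDagger : Submodule k (M.pt.carrier →ₗ[Aᵐᵒᵖ] A) where
  carrier := {φ | ∃ i, φ = φ ∘ₗ idem hM i}
  add_mem' := by
    rintro φ ψ ⟨i, hi⟩ ⟨j, hj⟩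
    obtain ⟨l, hil, hjl⟩ := exists_ge_ge i j
    refine ⟨l, ?_⟩
    rw [hi, hj, LinearMap.add_comp, LinearMap.comp_assoc, LinearMap.comp_assoc, idem_comp hM hil,
      idem_comp hM hjl]
  zero_mem' := ⟨Classical.arbitrary I, by simp⟩
  smul_mem' := by
    rintro a φ ⟨i, hi⟩
    exact ⟨i, by rw [LinearMap.smul_comp, ← hi]⟩

/-- The right action of `T†` on `M†`: `(φ · t) m = φ (t · m)`. -/
noncomputable def dualAct : dualDagger hM →ₗ[k] ColimEnd S k →ₗ[k] dualDagger hM :=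
  LinearMap.mk₂ k (fun φ t => ⟨φ.1 ∘ₗ Comod.toLin (toEnd hM k t), by
      obtain ⟨i, t, rfl⟩ := t.exists_of
      refine ⟨i, ?_⟩
      have h : (νc hM i ≫ μc M i) ≫ (νc hM i ≫ t ≫ μc M i) = νc hM i ≫ t ≫ μc M i := by
        rw [Category.assoc, ← Category.assoc (μc M i), μc_νc, Category.id_comp]
      have h' : Comod.toLin (νc hM i ≫ t ≫ μc M i) ∘ₗ idem hM i =
        Comod.toLin (νc hM i ≫ t ≫ μc M i) := congrArg Comod.toLin h
      rw [toEnd_of, LinearMap.comp_assoc, h']⟩)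
    (fun φ ψ t => rfl)
    (fun a φ t => rfl)
    (fun φ s t => by
      refine Subtype.ext (LinearMap.ext fun m => ?_)
      have : Comod.toLin (toEnd hM k (s + t)) m =
        Comod.toLin (toEnd hM k s) m + Comod.toLin (toEnd hM k t) m := by rw [map_add]; rfl
      exact (congrArg φ.1 this).trans (map_add _ _ _))
    (fun a φ t => by
      refine Subtype.ext (LinearMap.ext fun m => ?_)
      have : Comod.toLin (toEnd hM k (a • t)) m = a • Comod.toLin (toEnd hM k t) m := by
        rw [map_smul]; rfl
      exact (congrArg φ.1 this).trans ((φ.1.restrictScalars k).map_smul _ _))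

/-- The `k`-module underlying the comatrix coring `𝒢 = M† ⊗_{T†} M`. -/
abbrev ComatrixCoringCarrier : Type u :=
  BalTensor (N := dualDagger hM) (B := ColimEnd S k) (dualAct hM) (colimAct hM)

/-- The bilinear map `(φ, m) ↦ φ(m₀) m₁`, where `m₀ ⊗ m₁` is the coaction of `m`. -/
noncomputable def canAux : dualDagger hM →ₗ[k] M.pt.carrier →ₗ[k] C :=
  LinearMap.mk₂ k (fun φ m => TensorA.contractLeft k A φ.1 (M.pt.coact m))
    (fun φ ψ m => TensorA.contractLeft_add φ.1 ψ.1 _)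
    (fun a φ m => TensorA.contractLeft_smul a φ.1 _)
    (fun φ m m' => by rw [map_add, map_add])
    (fun a φ m => by
      rw [← map_smul]
      exact congrArg _ ((M.pt.coact.restrictScalars k).map_smul a m))

/-- The canonical map `can : M† ⊗_{T†} M → C`, `φ ⊗ m ↦ φ(m₀) m₁`, where `m₀ ⊗ m₁` is the
coaction of `m`. When the `M_i` are finitely generated projective over `A` this is a morphism of
corings, so it is an isomorphism of corings if and only if it is bijective. -/
noncomputable def can : ComatrixCoringCarrier hM →ₗ[k] C :=
  BalTensor.lift (canAux hM) (fun φ t m => by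
    have h := Comod.coact_toLin (toEnd hM k t) m
    exact (TensorA.contractLeft_comp φ.1 (Comod.toLin (toEnd hM k t)) (M.pt.coact m)).trans
      (congrArg (TensorA.contractLeft k A φ.1) h.symm))

end Galois

/-!
The equivalence is `N ↦ N ⊗_{T†} M`, from firm right `T†`-modules to `C`-comodules, where
`N ⊗_{T†} M` has the coaction of `M`. Its quasi-inverse is `X ↦ Hom^C(M, X)†`, the colinear maps
`f : M → X` with `f = f ∘ μ_i ∘ ν_i` for some `i`.

*The counit is an isomorphism.* For a right `A`-module `X` let `Hom_A(M, X)†` be the `A`-linear maps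
`f : M → X` with `f = f ∘ μ_i ∘ ν_i` for some `i`. As the `M_i` are finitely generated projective,
a dual basis writes each such `f` as a finite sum of maps `x · φ(-)` with `x ∈ X` and `φ ∈ M†`. So
bijectivity of `can : M† ⊗_{T†} M → C` gives `Hom_A(M, X)† ⊗_{T†} M ≅ X ⊗_A C`, through
`f ⊗ m ↦ f(m₀) ⊗ m₁` (`canHom_bijective`). If `X` is a comodule, then
`0 → Hom^C(M, X)† → Hom_A(M, X)† → Hom_A(M, X ⊗_A C)†` is exact, where the last map is
`f ↦ ρ_X ∘ f - (f ⊗ C) ∘ ρ_M`. By flatness it stays exact after `- ⊗_{T†} M`, and `canHom` takes the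
result to `0 → Hom^C(M, X)† ⊗_{T†} M → X ⊗_A C → X ⊗_A C ⊗_A C`, whose last map is
`ρ_X ⊗ C - X ⊗ Δ`. The coaction `ρ_X` is injective, its image lies in the kernel of that map, and
`ρ_X` after evaluation is the first map; so evaluation is an isomorphism
`Hom^C(M, X)† ⊗_{T†} M ≅ X` (`evalLin_bijective`).

*The unit is an isomorphism.* For firm `N`, the unit `η : N → Hom^C(M, N ⊗_{T†} M)†`,
`n ↦ (m ↦ n ⊗ m)`, satisfies `ev ∘ (η ⊗_{T†} M) = id`. Evaluation is bijective, hence so is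
`η ⊗_{T†} M`, and faithfulness gives that `η` is bijective (`unitHom_bijective`). A bijective unit
makes the functor fully faithful, and a bijective counit makes it essentially surjective.
-/

/-! ### Tensor products over `A` and comodules -/

namespace TensorA

variable {k : Type v} [CommRing k] {A : Type u} [Ring A] [Algebra k A]

section Map

variable {M M' M'' N N' N'' : Type*}
  [AddCommGroup M] [Module k M] [Module Aᵐᵒᵖ M] [IsScalarTower k Aᵐᵒᵖ M]
  [AddCommGroup M'] [Module k M'] [Module Aᵐᵒᵖ M'] [IsScalarTower k Aᵐᵒᵖ M']
  [AddCommGroup M''] [Module k M''] [Module Aᵐᵒᵖ M''] [IsScalarTower k Aᵐᵒᵖ M'']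
  [AddCommGroup N] [Module k N] [Module A N] [IsScalarTower k A N]
  [AddCommGroup N'] [Module k N'] [Module A N'] [IsScalarTower k A N']
  [AddCommGroup N''] [Module k N''] [Module A N''] [IsScalarTower k A N'']

theorem map_map (f' : M' →ₗ[Aᵐᵒᵖ] M'') (g' : N' →ₗ[A] N'') (f : M →ₗ[Aᵐᵒᵖ] M') (g : N →ₗ[A] N')
    (x : TensorA k A M N) :
    map k A f' g' (map k A f g x) = map k A (f' ∘ₗ f) (g' ∘ₗ g) x :=
  LinearMap.congr_fun (f := map k A f' g' ∘ₗ map k A f g) (hom_ext fun m n => by simp) x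

theorem map_add_left (f f' : M →ₗ[Aᵐᵒᵖ] M') (g : N →ₗ[A] N') (x : TensorA k A M N) :
    map k A (f + f') g x = map k A f g x + map k A f' g x :=
  LinearMap.congr_fun (g := map k A f g + map k A f' g) (hom_ext fun m n => by simp) x

theorem map_sub_left (f f' : M →ₗ[Aᵐᵒᵖ] M') (g : N →ₗ[A] N') (x : TensorA k A M N) :
    map k A (f - f') g x = map k A f g x - map k A f' g x :=
  LinearMap.congr_fun (g := map k A f g - map k A f' g) (hom_ext fun m n => by simp) x

theorem map_smul_left (c : k) (f : M →ₗ[Aᵐᵒᵖ] M') (g : N →ₗ[A] N') (x : TensorA k A M N) :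
    map k A (c • f) g x = c • map k A f g x :=
  LinearMap.congr_fun (g := c • map k A f g) (hom_ext fun m n => by simp) x

theorem map_id_id (x : TensorA k A M N) : map k A LinearMap.id LinearMap.id x = x :=
  LinearMap.congr_fun (g := LinearMap.id) (hom_ext fun m n => by simp) x

end Map

section MapRight

variable {M M' C D : Type*}
  [AddCommGroup M] [Module k M] [Module Aᵐᵒᵖ M] [IsScalarTower k Aᵐᵒᵖ M]
  [AddCommGroup M'] [Module k M'] [Module Aᵐᵒᵖ M'] [IsScalarTower k Aᵐᵒᵖ M']
  [AddCommGroup C] [Module k C] [Module A C] [Module Aᵐᵒᵖ C] [IsScalarTower k A C]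
  [IsScalarTower k Aᵐᵒᵖ C] [SMulCommClass A Aᵐᵒᵖ C]
  [AddCommGroup D] [Module k D] [Module A D] [IsScalarTower k A D]

variable (k C) in
/-- The map `f ⊗_A C`, as a right `A`-linear map. -/
def mapRight (f : M →ₗ[Aᵐᵒᵖ] M') : TensorA k A M C →ₗ[Aᵐᵒᵖ] TensorA k A M' C where
  toFun := map k A f LinearMap.id
  map_add' := map_add _
  map_smul' a x := by
    induction x using TensorA.induction_on with
    | zero => simp
    | tmul m n => simp
    | add x y hx hy => rw [right_smul_add, map_add, hx, hy, map_add, smul_add]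

@[simp] theorem mapRight_apply (f : M →ₗ[Aᵐᵒᵖ] M') (x : TensorA k A M C) :
    mapRight k C f x = map k A f LinearMap.id x := rfl

theorem assoc_map (f : M →ₗ[Aᵐᵒᵖ] M') (x : TensorA k A (TensorA k A M C) D) :
    assoc k A M' C D (map k A (mapRight k C f) LinearMap.id x) =
      map k A f LinearMap.id (assoc k A M C D x) := by
  induction x using TensorA.induction_on with
  | zero => simp
  | add x y hx hy => simp only [map_add, hx, hy]
  | tmul x d =>
    induction x using TensorA.induction_on with
    | zero => simp
    | add x y hx hy => simp only [map_add, LinearMap.add_apply, hx, hy]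
    | tmul m c => simp

variable (k C) in
/-- The map `c ↦ m ⊗ c`, as a right `A`-linear map. -/
def tmulRight (m : M) : C →ₗ[Aᵐᵒᵖ] TensorA k A M C where
  toFun := tmul k A m
  map_add' := map_add _
  map_smul' a c := (right_smul_tmul k A a m c).symm

@[simp] theorem tmulRight_apply (m : M) (c : C) : tmulRight k C m c = tmul k A m c := rfl

variable (k A M C D) in
/-- The map `M ⊗_A (C ⊗_A D) → (M ⊗_A C) ⊗_A D`, inverse to `TensorA.assoc`. -/
def assocSymm : TensorA k A M (TensorA k A C D) →ₗ[k] TensorA k A (TensorA k A M C) D :=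
  lift k A
    (LinearMap.mk₂ k (fun m => map k A (tmulRight k C m) LinearMap.id)
      (fun m m' x => by
        have : tmulRight k C (m + m') = tmulRight k C m + tmulRight (A := A) k C m' := by
          ext; simp
        rw [this, map_add_left])
      (fun a m x => by
        have : tmulRight k C (a • m) = a • tmulRight (A := A) k C m := by ext; simp
        rw [this, map_smul_left])
      (fun m x y => map_add _ _ _) (fun a m x => map_smul _ _ _))
    (fun m a x => by
      have : tmulRight k C (op a • m) = tmulRight k C m ∘ₗ leftMul A C a := by
        ext; simp [leftMul, smul_tmul]
      change map k A (tmulRight k C (op a • m)) LinearMap.id x =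
        map k A (tmulRight k C m) LinearMap.id (map k A (leftMul A C a) LinearMap.id x)
      rw [this, map_map]
      rfl)

theorem assocSymm_assoc (x : TensorA k A (TensorA k A M C) D) :
    assocSymm k A M C D (assoc k A M C D x) = x := by
  induction x using TensorA.induction_on with
  | zero => simp
  | add x y hx hy => simp only [map_add, hx, hy]
  | tmul x d =>
    induction x using TensorA.induction_on with
    | zero => simp
    | add x y hx hy => simp only [map_add, LinearMap.add_apply, hx, hy]
    | tmul m c => simp [assocSymm]

theorem assoc_injective : Function.Injective (assoc k A M C D) :=
  Function.LeftInverse.injective (g := assocSymm k A M C D) assocSymm_assoc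

end MapRight

end TensorA

namespace Comod

variable {k : Type v} [CommRing k] {A : Type u} [Ring A] [Algebra k A]
  {C : Type u} [AddCommGroup C] [Module k C] [Module A C] [Module Aᵐᵒᵖ C]
  [IsScalarTower k A C] [IsScalarTower k Aᵐᵒᵖ C] [SMulCommClass A Aᵐᵒᵖ C] [Coring k A C]

theorem coact_injective (X : Comod k A C) : Function.Injective X.coact :=
  Function.LeftInverse.injective X.coact_counit

theorem isIso_of_bijective {X Y : Comod k A C} (f : X ⟶ Y)
    (hf : Function.Bijective (toLin f)) : IsIso f := by
  let e := LinearEquiv.ofBijective (toLin f) hf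
  have he : e.symm.toLinearMap ∘ₗ toLin f = LinearMap.id :=
    LinearMap.ext fun x => e.symm_apply_apply x
  refine ⟨⟨⟨e.symm.toLinearMap, fun y => ?_⟩, ?_, ?_⟩⟩
  · obtain ⟨x, rfl⟩ := hf.2 y
    have hx : e.symm.toLinearMap (toLin f x) = x := e.symm_apply_apply x
    rw [hx, coact_toLin, TensorA.map_map, he]
    exact (TensorA.map_id_id _).symm
  · exact hom_ext fun x => e.symm_apply_apply x
  · exact hom_ext fun y => e.apply_symm_apply y

end Comod

/-! ### Firm modules over a ring with local units -/

namespace RMod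

set_option linter.unusedSectionVars false

variable {k : Type v} [CommRing k] {B : Type u} [NonUnitalRing B] [Module k B]
  [IsScalarTower k B B] [SMulCommClass k B B]

theorem hom_ext {N N' : RMod k B} {f g : N ⟶ N'} (h : ∀ n, toLin f n = toLin g n) : f = g :=
  Hom.ext (LinearMap.ext h)

/-- The zero morphism between two right `B`-modules. -/
def zeroHom (N N' : RMod k B) : N ⟶ N' :=
  Hom.mk 0 (fun n b => by simp)

@[simp] theorem toLin_zeroHom (N N' : RMod k B) : toLin (zeroHom N N') = 0 := rfl

@[simp] theorem mulMap_tmul (N : RMod k B) (n : N.carrier) (b : B) :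
    N.mulMap (BalTensor.tmul _ _ n b) = N.act n b :=
  BalTensor.lift_tmul _ _ _ _

section TensorMap

variable {P : Type u} [AddCommGroup P] [Module k P] (l : B →ₗ[k] P →ₗ[k] P)

@[simp] theorem tensorMap_tmul {N N' : RMod k B} (f : N ⟶ N') (n : N.carrier) (p : P) :
    tensorMap l f (BalTensor.tmul _ _ n p) = BalTensor.tmul _ _ (toLin f n) p :=
  BalTensor.map_tmul _ _ _ _ _ _

theorem tensorMap_zeroHom (N N' : RMod k B) : tensorMap l (zeroHom N N') = 0 :=
  BalTensor.hom_ext fun n p => by simp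

variable {l}

theorem injective_of_exact_zeroHom {N N' : RMod k B} {f : N ⟶ N'}
    (h : Function.Exact (toLin (zeroHom N N)) (toLin f)) : Function.Injective (toLin f) :=
  (injective_iff_map_eq_zero _).2 fun n hn => by
    obtain ⟨n', rfl⟩ := (h n).1 hn
    rfl

theorem exact_zero_of_injective {E F G : Type*} [AddCommGroup E] [Module k E] [AddCommGroup F]
    [Module k F] [AddCommGroup G] [Module k G] {f : F →ₗ[k] G} (h : Function.Injective f) :
    Function.Exact (0 : E →ₗ[k] F) f := fun x =>
  ⟨fun hx => ⟨0, by simpa using ((injective_iff_map_eq_zero f).1 h x hx).symm⟩, by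
    rintro ⟨y, rfl⟩; simp⟩

theorem exact_zero_of_surjective {E F G : Type*} [AddCommGroup E] [Module k E] [AddCommGroup F]
    [Module k F] [AddCommGroup G] [Module k G] {f : E →ₗ[k] F} (h : Function.Surjective f) :
    Function.Exact f (0 : F →ₗ[k] G) := fun x => ⟨fun _ => h x, fun _ => rfl⟩

/-- A flat action preserves injections. -/
theorem tensorMap_injective (hl : IsFlatAction l) {N N' : RMod k B} (f : N ⟶ N')
    (hf : Function.Injective (toLin f)) : Function.Injective (tensorMap l f) := by
  have h := hl (zeroHom N N) f (exact_zero_of_injective hf)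
  rw [tensorMap_zeroHom] at h
  refine (injective_iff_map_eq_zero _).2 fun n hn => ?_
  obtain ⟨n', rfl⟩ := (h n).1 hn
  rfl

/-- A faithfully flat action reflects isomorphisms between firm modules: `f` is bijective if and
only if `0 → N → N' → 0` is exact. -/
theorem bijective_of_tensorMap_bijective (hl : IsFaithfullyFlatAction l) {N N' : RMod k B}
    (hN : IsFirm k B N) (hN' : IsFirm k B N') (f : N ⟶ N')
    (hf : Function.Bijective (tensorMap l f)) : Function.Bijective (toLin f) := by
  constructor
  · refine injective_of_exact_zeroHom (hl.2 hN hN hN' (zeroHom N N) f ?_)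
    rw [tensorMap_zeroHom]
    exact exact_zero_of_injective hf.1
  · have h := hl.2 hN hN' hN' f (zeroHom N' N') (by
      rw [tensorMap_zeroHom]
      exact exact_zero_of_surjective hf.2)
    exact fun n => (h n).1 rfl

end TensorMap

/-- The inverse of a bijective morphism. -/
noncomputable def invHom {N N' : RMod k B} (f : N ⟶ N') (hf : Function.Bijective (toLin f)) :
    N' ⟶ N :=
  Hom.mk (LinearEquiv.ofBijective (toLin f) hf).symm (fun n b => by
    apply hf.1
    have key (x) : toLin f ((LinearEquiv.ofBijective (toLin f) hf).symm x) = x :=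
      (LinearEquiv.ofBijective (toLin f) hf).apply_symm_apply x
    rw [toLin_act]
    exact (key _).trans (congrArg (N'.act · b) (key n).symm))

theorem toLin_invHom {N N' : RMod k B} (f : N ⟶ N') (hf : Function.Bijective (toLin f))
    (x : N'.carrier) : toLin f (toLin (invHom f hf) x) = x :=
  (LinearEquiv.ofBijective (toLin f) hf).apply_symm_apply x

section LocalUnits

variable {I : Type*} [Preorder I] [IsDirectedOrder I] [Nonempty I] {e : I → B}

/-- Let the `e i` be right local units of `B`, increasing in `i`. Then a right `B`-module in which
each element is fixed by some `e i` is firm: the inverse of multiplication is `n ↦ n ⊗ e i`, for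
large `i`. -/
theorem isFirm_of_exists (he : ∀ b : B, ∃ i, ∀ j, i ≤ j → b * e j = b) (N : RMod k B)
    (hN : ∀ n, ∃ i, N.act n (e i) = n) : IsFirm k B N := by
  constructor
  · have key (z : BalTensor N.act (LinearMap.mul k B)) :
        ∃ i, ∀ j, i ≤ j → z = BalTensor.tmul _ _ (N.mulMap z) (e j) := by
      induction z using BalTensor.induction_on with
      | zero => exact ⟨Classical.arbitrary I, by simp⟩
      | tmul n b =>
        obtain ⟨i, hi⟩ := he b
        refine ⟨i, fun j hj => ?_⟩
        rw [mulMap_tmul, BalTensor.tmul_balanced, LinearMap.mul_apply', hi j hj]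
      | add x y hx hy =>
        obtain ⟨i, hi⟩ := hx
        obtain ⟨j, hj⟩ := hy
        obtain ⟨l, hil, hjl⟩ := exists_ge_ge i j
        refine ⟨l, fun m hm => ?_⟩
        rw [map_add, map_add, LinearMap.add_apply, ← hi m (hil.trans hm), ← hj m (hjl.trans hm)]
    refine (injective_iff_map_eq_zero _).2 fun z hz => ?_
    obtain ⟨i, hi⟩ := key z
    rw [hi i le_rfl, hz, map_zero, LinearMap.zero_apply]
  · intro n
    obtain ⟨i, hi⟩ := hN n
    exact ⟨BalTensor.tmul _ _ n (e i), by rw [mulMap_tmul, hi]⟩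

theorem exists_of_isFirm (he : ∀ b : B, ∃ i, ∀ j, i ≤ j → b * e j = b) (N : RMod k B)
    (hN : IsFirm k B N) (n : N.carrier) : ∃ i, ∀ j, i ≤ j → N.act n (e j) = n := by
  obtain ⟨z, rfl⟩ := hN.2 n
  induction z using BalTensor.induction_on with
  | zero => exact ⟨Classical.arbitrary I, by simp⟩
  | tmul n b =>
    obtain ⟨i, hi⟩ := he b
    exact ⟨i, fun j hj => by rw [mulMap_tmul, ← N.act_mul, hi j hj]⟩
  | add x y hx hy =>
    obtain ⟨i, hi⟩ := hx
    obtain ⟨j, hj⟩ := hy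
    obtain ⟨l, hil, hjl⟩ := exists_ge_ge i j
    exact ⟨l, fun m hm => by
      rw [map_add, map_add, LinearMap.add_apply, hi m (hil.trans hm), hj m (hjl.trans hm)]⟩

end LocalUnits

end RMod

/-! ### The module `Hom_A(M, X)†` -/

section Galois

set_option linter.unusedSectionVars false

open SplitSystem

variable {k : Type v} [CommRing k] {A : Type u} [Ring A] [Algebra k A]
  {C : Type u} [AddCommGroup C] [Module k C] [Module A C] [Module Aᵐᵒᵖ C]
  [IsScalarTower k A C] [IsScalarTower k Aᵐᵒᵖ C] [SMulCommClass A Aᵐᵒᵖ C] [Coring k A C]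
  {I : Type u} [PartialOrder I] [IsDirectedOrder I] [Nonempty I]
  {S : I ⥤ SplitCat (Comod k A C)}
  {M : Cocone (S ⋙ SplitCat.forget (Comod k A C))} (hM : IsColimit M)

variable (k S) in
/-- The idempotent of `T†` given by the identity of `M_i`. -/
noncomputable def localUnit (i : I) : ColimEnd S k := ColimEnd.of S k i (1 : End (S.obj i).of)

theorem of_endMap {i j : I} (h : i ≤ j) (t : End (S.obj i).of) :
    ColimEnd.of S k j (endMap S k i j h t) = ColimEnd.of S k i t :=
  DirectLimit.NonUnitalAlgebra.of_f (f := fun i j h => endMap S k i j h) h t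

theorem mul_localUnit (t : ColimEnd S k) :
    ∃ i, ∀ j, i ≤ j → t * localUnit k S j = t := by
  obtain ⟨i, t, rfl⟩ := t.exists_of
  refine ⟨i, fun j h => ?_⟩
  rw [← of_endMap h, localUnit, ← map_mul, mul_one]

theorem colimAct_apply (t : ColimEnd S k) (m : M.pt.carrier) :
    colimAct hM t m = Comod.toLin (toEnd hM k t) m := rfl

theorem toLin_toEnd_localUnit (i : I) :
    Comod.toLin (toEnd hM k (localUnit k S i)) = idem hM i := by
  rw [localUnit, toEnd_of]
  exact congrArg (fun f => Comod.toLin (νc hM i ≫ f)) (Category.id_comp (μc M i))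

theorem toLin_toEnd_mul (s t : ColimEnd S k) :
    Comod.toLin (toEnd hM k (s * t)) =
      Comod.toLin (toEnd hM k s) ∘ₗ Comod.toLin (toEnd hM k t) := by
  rw [map_mul]
  rfl

theorem toLin_toEnd_comp_idem (t : ColimEnd S k) :
    ∃ i, Comod.toLin (toEnd hM k t) ∘ₗ idem hM i = Comod.toLin (toEnd hM k t) := by
  obtain ⟨i, hi⟩ := mul_localUnit t
  refine ⟨i, ?_⟩
  rw [← toLin_toEnd_localUnit (k := k), ← toLin_toEnd_mul, hi i le_rfl]

section HomDagger

variable (X : Type u) [AddCommGroup X] [Module k X] [Module Aᵐᵒᵖ X] [IsScalarTower k Aᵐᵒᵖ X]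

/-- `Hom_A(M, X)†`: the right `A`-linear maps `f : M → X` with `f = f ∘ μ_i ∘ ν_i` for some `i`. For
`X = A` this is `M†`. -/
noncomputable def homDagger : Submodule k (M.pt.carrier →ₗ[Aᵐᵒᵖ] X) where
  carrier := {f | ∃ i, f = f ∘ₗ idem hM i}
  add_mem' := by
    rintro f g ⟨i, hi⟩ ⟨j, hj⟩
    obtain ⟨l, hil, hjl⟩ := exists_ge_ge i j
    refine ⟨l, ?_⟩
    rw [hi, hj, LinearMap.add_comp, LinearMap.comp_assoc, LinearMap.comp_assoc, idem_comp hM hil,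
      idem_comp hM hjl]
  zero_mem' := ⟨Classical.arbitrary I, by simp⟩
  smul_mem' := by
    rintro a f ⟨i, hi⟩
    exact ⟨i, by rw [LinearMap.smul_comp, ← hi]⟩

/-- `Hom_A(M, X)†` as a right `T†`-module, by precomposition. -/
noncomputable def homDaggerMod : RMod k (ColimEnd S k) where
  carrier := homDagger hM X
  act := LinearMap.mk₂ k
    (fun f t => ⟨f.1 ∘ₗ Comod.toLin (toEnd hM k t), by
      obtain ⟨i, hi⟩ := toLin_toEnd_comp_idem hM t
      exact ⟨i, by rw [LinearMap.comp_assoc, hi]⟩⟩)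
    (fun f g t => rfl)
    (fun a f t => rfl)
    (fun f s t => Subtype.ext <| LinearMap.ext fun m => by
      have : Comod.toLin (toEnd hM k (s + t)) m =
        Comod.toLin (toEnd hM k s) m + Comod.toLin (toEnd hM k t) m := by rw [map_add]; rfl
      exact (congrArg f.1 this).trans (map_add _ _ _))
    (fun a f t => Subtype.ext <| LinearMap.ext fun m => by
      have : Comod.toLin (toEnd hM k (a • t)) m = a • Comod.toLin (toEnd hM k t) m := by
        rw [map_smul]; rfl
      exact (congrArg f.1 this).trans ((f.1.restrictScalars k).map_smul _ _))
  act_mul f s t := Subtype.ext <| LinearMap.ext fun m => by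
    simp

/-- The linear map underlying an element of `Hom_A(M, X)†`. -/
noncomputable def homDaggerMod.val {X : Type u} [AddCommGroup X] [Module k X] [Module Aᵐᵒᵖ X]
    [IsScalarTower k Aᵐᵒᵖ X] :
    (homDaggerMod hM X).carrier →ₗ[k] (M.pt.carrier →ₗ[Aᵐᵒᵖ] X) := (homDagger hM X).subtype

end HomDagger

/-! ### The canonical map with coefficients in an `A`-module -/

section HomDagger

variable {X : Type u} [AddCommGroup X] [Module k X] [Module Aᵐᵒᵖ X] [IsScalarTower k Aᵐᵒᵖ X]

namespace homDaggerMod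

/-- A right `A`-linear map with `f = f ∘ μ_i ∘ ν_i`, as an element of `Hom_A(M, X)†`. -/
noncomputable def mk (f : M.pt.carrier →ₗ[Aᵐᵒᵖ] X) (hf : ∃ i, f = f ∘ₗ idem hM i) :
    (homDaggerMod hM X).carrier := (⟨f, hf⟩ : homDagger hM X)

theorem ext {f g : (homDaggerMod hM X).carrier} (h : ∀ m, val hM f m = val hM g m) : f = g :=
  Subtype.ext (LinearMap.ext h)

@[simp] theorem val_act (f : (homDaggerMod hM X).carrier) (t : ColimEnd S k) :
    val hM ((homDaggerMod hM X).act f t) = val hM f ∘ₗ Comod.toLin (toEnd hM k t) := rfl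

theorem exists_idem (f : (homDaggerMod hM X).carrier) :
    ∃ i, val hM f = val hM f ∘ₗ idem hM i := f.2

end homDaggerMod

open homDaggerMod

variable (A) in
/-- The right `A`-linear map `A → X`, `a ↦ x · a`. -/
def orbitMap (x : X) : A →ₗ[Aᵐᵒᵖ] X where
  toFun a := op a • x
  map_add' a b := by rw [MulOpposite.op_add, add_smul]
  map_smul' a b := by simp [mul_smul]

@[simp] theorem orbitMap_apply (x : X) (a : A) : orbitMap A x a = op a • x := rfl

/-- The morphism `M† → Hom_A(M, X)†` of right `T†`-modules, `φ ↦ x · φ(-)`. -/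
noncomputable def orbitHom (x : X) : homDaggerMod hM A ⟶ homDaggerMod hM X :=
  RMod.Hom.mk
    (LinearMap.codRestrict (homDagger hM X)
      { toFun := fun φ => orbitMap A x ∘ₗ val hM φ
        map_add' := fun φ ψ => by rw [map_add, LinearMap.comp_add]
        map_smul' := fun a φ => by
          ext m
          exact ((orbitMap A x).restrictScalars k).map_smul a (val hM φ m) }
      (fun φ => by
        obtain ⟨i, hi⟩ := exists_idem hM φ
        refine ⟨i, ?_⟩
        change orbitMap A x ∘ₗ val hM φ = (orbitMap A x ∘ₗ val hM φ) ∘ₗ idem hM i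
        rw [LinearMap.comp_assoc, ← hi]))
    (fun φ t => rfl)

@[simp] theorem val_orbitHom (x : X) (φ : (homDaggerMod hM A).carrier) :
    val hM (RMod.toLin (orbitHom hM x) φ) = orbitMap A x ∘ₗ val hM φ := rfl

variable (X) in
/-- The map `Hom_A(M, X)† ⊗_{T†} M → X ⊗_A C`, `f ⊗ m ↦ f(m₀) ⊗ m₁`; for `X = A` this is `can`. -/
noncomputable def canHom :
    BalTensor (homDaggerMod hM X).act (colimAct hM) →ₗ[k] TensorA k A X C :=
  BalTensor.lift
    (LinearMap.mk₂ k (fun f m => TensorA.map k A (val hM f) LinearMap.id (M.pt.coact m))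
      (fun f g m => by rw [map_add, TensorA.map_add_left])
      (fun a f m => by rw [map_smul, TensorA.map_smul_left])
      (fun f m m' => by rw [map_add, map_add])
      (fun a f m => by
        rw [← map_smul]
        exact congrArg _ ((M.pt.coact.restrictScalars k).map_smul a m)))
    (fun f t m => by
      simp only [LinearMap.mk₂_apply, val_act, colimAct_apply, Comod.coact_toLin, TensorA.map_map]
      rfl)

@[simp] theorem canHom_tmul (f : (homDaggerMod hM X).carrier) (m : M.pt.carrier) :
    canHom hM X (BalTensor.tmul _ _ f m) =
      TensorA.map k A (val hM f) LinearMap.id (M.pt.coact m) :=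
  BalTensor.lift_tmul _ _ _ _

/-- The bijection `can`, with `M†` written as `Hom_A(M, A)†`. -/
noncomputable def canEquiv (hG : Function.Bijective (can hM)) :
    BalTensor (homDaggerMod hM A).act (colimAct hM) ≃ₗ[k] C :=
  LinearEquiv.ofBijective (can hM) hG

@[simp] theorem canEquiv_tmul (hG : Function.Bijective (can hM))
    (φ : (homDaggerMod hM A).carrier) (m : M.pt.carrier) :
    canEquiv hM hG (BalTensor.tmul _ _ φ m) =
      TensorA.contractLeft k A (val hM φ) (M.pt.coact m) := by
  have h : can hM (BalTensor.tmul _ _ φ m) = canAux hM φ m := BalTensor.lift_tmul _ _ _ _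
  exact h

/-- Every element of `Hom_A(M, X)†` is a finite sum of elements `x · φ(-)` with `φ ∈ M†`: for
`f = f ∘ μ_i ∘ ν_i`, expand `ν_i m` in a dual basis of the finitely generated projective `M_i`. -/
theorem exists_eq_sum_orbitHom (hfin : ∀ i, Module.Finite Aᵐᵒᵖ (S.obj i).of.carrier)
    (hproj : ∀ i, Module.Projective Aᵐᵒᵖ (S.obj i).of.carrier)
    (f : (homDaggerMod hM X).carrier) :
    ∃ (n : ℕ) (x : Fin n → X) (φ : Fin n → (homDaggerMod hM A).carrier),
      f = ∑ s, RMod.toLin (orbitHom hM (x s)) (φ s) := by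
  obtain ⟨i, hi⟩ := exists_idem hM f
  obtain ⟨n, π, hπ⟩ := Module.Finite.exists_fin' Aᵐᵒᵖ (S.obj i).of.carrier
  obtain ⟨σ, hσ⟩ := Module.projective_lifting_property π LinearMap.id hπ
  let unopLin : Aᵐᵒᵖ →ₗ[Aᵐᵒᵖ] A :=
    { toFun := unop
      map_add' := fun _ _ => rfl
      map_smul' := fun _ _ => rfl }
  have hν : Comod.toLin (νc hM i) ∘ₗ idem hM i = Comod.toLin (νc hM i) := by
    have : (νc hM i ≫ μc M i) ≫ νc hM i = νc hM i := by
      rw [Category.assoc, μc_νc, Category.comp_id]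
    exact congrArg Comod.toLin this
  refine ⟨n, fun s => val hM f (Comod.toLin (μc M i) (π (Pi.single s 1))),
    fun s => mk hM (unopLin ∘ₗ LinearMap.proj s ∘ₗ σ ∘ₗ Comod.toLin (νc hM i)) ⟨i, ?_⟩, ?_⟩
  · simp only [LinearMap.comp_assoc, hν]
  · refine homDaggerMod.ext hM fun m => ?_
    have hπσ : Comod.toLin (νc hM i) m = π (σ (Comod.toLin (νc hM i) m)) :=
      (LinearMap.congr_fun hσ _).symm
    have hid : idem hM i m = Comod.toLin (μc M i) (Comod.toLin (νc hM i) m) := rfl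
    rw [map_sum, LinearMap.sum_apply, hi, LinearMap.comp_apply, hid, hπσ,
      pi_eq_sum_univ' (σ (Comod.toLin (νc hM i) m))]
    simp only [map_sum, map_smul]
    rw [← hi]
    rfl

variable (k A C) in
theorem map_orbitMap_comp (x : X) (φ : M.pt.carrier →ₗ[Aᵐᵒᵖ] A)
    (y : TensorA k A M.pt.carrier C) :
    TensorA.map k A (orbitMap A x ∘ₗ φ) LinearMap.id y =
      TensorA.tmul k A x (TensorA.contractLeft k A φ y) := by
  induction y using TensorA.induction_on with
  | zero => simp
  | tmul m c => simp [TensorA.smul_tmul]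
  | add y y' hy hy' => simp only [map_add, hy, hy']

theorem canHom_orbitHom (hG : Function.Bijective (can hM)) (x : X)
    (z : BalTensor (homDaggerMod hM A).act (colimAct hM)) :
    canHom hM X (RMod.tensorMap (colimAct hM) (orbitHom hM x) z) =
      TensorA.tmul k A x (canEquiv hM hG z) := by
  induction z using BalTensor.induction_on with
  | zero => simp
  | tmul φ m => simp [map_orbitMap_comp]
  | add y y' hy hy' => simp only [map_add, hy, hy']

/-- `can` is left `A`-linear, where the action of `a` on `M† ⊗_{T†} M` is induced by `orbitHom hM a`. -/
theorem canEquiv_orbitHom (hG : Function.Bijective (can hM)) (a : A)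
    (z : BalTensor (homDaggerMod hM A).act (colimAct hM)) :
    canEquiv hM hG (RMod.tensorMap (colimAct hM) (orbitHom hM a) z) = a • canEquiv hM hG z := by
  induction z using BalTensor.induction_on with
  | zero => simp
  | add y y' hy hy' => simp only [map_add, hy, hy', smul_add]
  | tmul φ m =>
    simp only [RMod.tensorMap_tmul, canEquiv_tmul, val_orbitHom]
    generalize M.pt.coact m = y
    induction y using TensorA.induction_on with
    | zero => simp
    | tmul m c => simp [mul_smul]
    | add y y' hy hy' => simp only [map_add, hy, hy', smul_add]

section OrbitHom

variable (z : BalTensor (homDaggerMod hM A).act (colimAct hM))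

theorem tensorMap_orbitHom_add (x y : X) :
    RMod.tensorMap (colimAct hM) (orbitHom hM (x + y)) z =
      RMod.tensorMap (colimAct hM) (orbitHom hM x) z +
        RMod.tensorMap (colimAct hM) (orbitHom hM y) z := by
  induction z using BalTensor.induction_on with
  | zero => simp
  | tmul φ m =>
    have : RMod.toLin (orbitHom hM (x + y)) φ =
        RMod.toLin (orbitHom hM x) φ + RMod.toLin (orbitHom hM y) φ :=
      homDaggerMod.ext hM fun m => by simp
    simp only [RMod.tensorMap_tmul, this, map_add, LinearMap.add_apply]
  | add z z' hz hz' => simp only [map_add, hz, hz']; abel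

theorem tensorMap_orbitHom_smul (a : k) (x : X) :
    RMod.tensorMap (colimAct hM) (orbitHom hM (a • x)) z =
      a • RMod.tensorMap (colimAct hM) (orbitHom hM x) z := by
  induction z using BalTensor.induction_on with
  | zero => simp
  | tmul φ m =>
    have : RMod.toLin (orbitHom hM (a • x)) φ = a • RMod.toLin (orbitHom hM x) φ :=
      homDaggerMod.ext hM fun m => by simp [smul_comm _ a x]
    simp only [RMod.tensorMap_tmul, this, map_smul, LinearMap.smul_apply]
  | add z z' hz hz' => simp only [map_add, hz, hz', smul_add]

theorem tensorMap_orbitHom_op_smul (x : X) (a : A) :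
    RMod.tensorMap (colimAct hM) (orbitHom hM (op a • x)) z =
      RMod.tensorMap (colimAct hM) (orbitHom hM x)
        (RMod.tensorMap (colimAct hM) (orbitHom hM a) z) := by
  induction z using BalTensor.induction_on with
  | zero => simp
  | tmul φ m =>
    have : RMod.toLin (orbitHom hM (op a • x)) φ =
        RMod.toLin (orbitHom hM x) (RMod.toLin (orbitHom hM a) φ) :=
      homDaggerMod.ext hM fun m => by simp [mul_smul]
    simp only [RMod.tensorMap_tmul, this]
  | add z z' hz hz' => simp only [map_add, hz, hz']

end OrbitHom

variable (X) in
/-- The inverse of `canHom`, `x ⊗ can(φ ⊗ m) ↦ x · φ(-) ⊗ m`. -/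
noncomputable def canHomInv (hG : Function.Bijective (can hM)) :
    TensorA k A X C →ₗ[k] BalTensor (homDaggerMod hM X).act (colimAct hM) :=
  TensorA.lift k A
    (LinearMap.mk₂ k (fun x c =>
      RMod.tensorMap (colimAct hM) (orbitHom hM x) ((canEquiv hM hG).symm c))
      (fun x y c => tensorMap_orbitHom_add hM _ x y)
      (fun a x c => tensorMap_orbitHom_smul hM _ a x)
      (fun x c c' => by rw [map_add, map_add])
      (fun a x c => by rw [map_smul, map_smul]))
    (fun x a c => by
      have h : (canEquiv hM hG).symm (a • c) =
          RMod.tensorMap (colimAct hM) (orbitHom hM a) ((canEquiv hM hG).symm c) := by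
        rw [LinearEquiv.symm_apply_eq, canEquiv_orbitHom, LinearEquiv.apply_symm_apply]
      rw [LinearMap.mk₂_apply, LinearMap.mk₂_apply, h, tensorMap_orbitHom_op_smul])

theorem canHomInv_tmul (hG : Function.Bijective (can hM)) (x : X) (c : C) :
    canHomInv hM X hG (TensorA.tmul k A x c) =
      RMod.tensorMap (colimAct hM) (orbitHom hM x) ((canEquiv hM hG).symm c) :=
  TensorA.lift_tmul _ _ _ _ _ _

variable (X) in
/-- If `can` is bijective and the `M_i` are finitely generated projective, then
`Hom_A(M, X)† ⊗_{T†} M ≅ X ⊗_A C` for every right `A`-module `X`. -/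
theorem canHom_bijective (hfin : ∀ i, Module.Finite Aᵐᵒᵖ (S.obj i).of.carrier)
    (hproj : ∀ i, Module.Projective Aᵐᵒᵖ (S.obj i).of.carrier)
    (hG : Function.Bijective (can hM)) : Function.Bijective (canHom hM X) := by
  refine Function.bijective_iff_has_inverse.2 ⟨canHomInv hM X hG, fun z => ?_, fun y => ?_⟩
  · induction z using BalTensor.induction_on with
    | zero => simp
    | add z z' hz hz' => simp only [map_add, hz, hz']
    | tmul f m =>
      obtain ⟨n, x, φ, rfl⟩ := exists_eq_sum_orbitHom hM hfin hproj f
      rw [map_sum, LinearMap.sum_apply, map_sum, map_sum]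
      refine Finset.sum_congr rfl fun s _ => ?_
      rw [← RMod.tensorMap_tmul, canHom_orbitHom hM hG, canHomInv_tmul,
        LinearEquiv.symm_apply_apply]
  · induction y using TensorA.induction_on with
    | zero => simp
    | tmul x c => rw [canHomInv_tmul, canHom_orbitHom hM hG, LinearEquiv.apply_symm_apply]
    | add y y' hy hy' => simp only [map_add, hy, hy']

end HomDagger

/-! ### The functor `- ⊗_{T†} M` to comodules -/


theorem TensorA.contractRight_map {X X' : Type*} [AddCommGroup X] [Module k X] [Module Aᵐᵒᵖ X]
    [IsScalarTower k Aᵐᵒᵖ X] [AddCommGroup X'] [Module k X'] [Module Aᵐᵒᵖ X']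
    [IsScalarTower k Aᵐᵒᵖ X'] (e : C →ₗ[A] A) (f : X →ₗ[Aᵐᵒᵖ] X') (y : TensorA k A X C) :
    TensorA.contractRight k A e (TensorA.map k A f LinearMap.id y) =
      f (TensorA.contractRight k A e y) := by
  induction y using TensorA.induction_on with
  | zero => simp
  | tmul x c => simp
  | add y y' hy hy' => simp only [map_add, hy, hy']

section TensorComod

variable (N : RMod k (ColimEnd S k))

noncomputable instance : SMul Aᵐᵒᵖ (BalTensor N.act (colimAct hM)) :=
  ⟨fun a => BalTensor.map LinearMap.id (Algebra.lsmul k k M.pt.carrier a) (fun _ _ => rfl)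
    (fun t m => ((Comod.toLin (toEnd hM k t)).map_smul a m).symm)⟩

@[simp] theorem op_smul_balTensor_tmul (a : Aᵐᵒᵖ) (n : N.carrier) (m : M.pt.carrier) :
    a • BalTensor.tmul N.act (colimAct hM) n m = BalTensor.tmul N.act (colimAct hM) n (a • m) :=
  BalTensor.map_tmul _ _ _ _ _ _

theorem op_smul_balTensor_zero (a : Aᵐᵒᵖ) : a • (0 : BalTensor N.act (colimAct hM)) = 0 :=
  map_zero (BalTensor.map LinearMap.id (Algebra.lsmul k k M.pt.carrier a) _ _)

theorem op_smul_balTensor_add (a : Aᵐᵒᵖ) (x y : BalTensor N.act (colimAct hM)) :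
    a • (x + y) = a • x + a • y :=
  map_add (BalTensor.map LinearMap.id (Algebra.lsmul k k M.pt.carrier a) _ _) x y

noncomputable instance : Module Aᵐᵒᵖ (BalTensor N.act (colimAct hM)) where
  smul_zero := op_smul_balTensor_zero hM N
  smul_add := op_smul_balTensor_add hM N
  one_smul x := by
    induction x using BalTensor.induction_on with
    | zero => rw [op_smul_balTensor_zero]
    | tmul n m => simp
    | add x y hx hy => rw [op_smul_balTensor_add, hx, hy]
  mul_smul a b x := by
    induction x using BalTensor.induction_on with
    | zero => simp only [op_smul_balTensor_zero]
    | tmul n m => simp [mul_smul]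
    | add x y hx hy => simp only [op_smul_balTensor_add, hx, hy]
  add_smul a b x := by
    induction x using BalTensor.induction_on with
    | zero => simp only [op_smul_balTensor_zero, add_zero]
    | tmul n m => simp [add_smul]
    | add x y hx hy => simp only [op_smul_balTensor_add, hx, hy]; abel
  zero_smul x := by
    induction x using BalTensor.induction_on with
    | zero => rw [op_smul_balTensor_zero]
    | tmul n m => simp
    | add x y hx hy => simp only [op_smul_balTensor_add, hx, hy, add_zero]

instance : IsScalarTower k Aᵐᵒᵖ (BalTensor N.act (colimAct hM)) where
  smul_assoc c a x := by
    induction x using BalTensor.induction_on with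
    | zero => simp
    | tmul n m => simp
    | add x y hx hy => simp only [smul_add, hx, hy]

variable {N} in
/-- The map `M → N ⊗_{T†} M`, `m ↦ n ⊗ m`, as a right `A`-linear map. -/
noncomputable def insertLeft (n : N.carrier) :
    M.pt.carrier →ₗ[Aᵐᵒᵖ] BalTensor N.act (colimAct hM) where
  toFun := BalTensor.tmul N.act (colimAct hM) n
  map_add' := map_add _
  map_smul' a m := (op_smul_balTensor_tmul hM N a n m).symm

variable {N} in
@[simp] theorem insertLeft_apply (n : N.carrier) (m : M.pt.carrier) :
    insertLeft hM n m = BalTensor.tmul N.act (colimAct hM) n m := rfl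

/-- The coaction `n ⊗ m ↦ (n ⊗ m₀) ⊗ m₁` of `N ⊗_{T†} M`, as a `k`-linear map. -/
noncomputable def tensorCoactAux :
    BalTensor N.act (colimAct hM) →ₗ[k] TensorA k A (BalTensor N.act (colimAct hM)) C :=
  BalTensor.lift
    (LinearMap.mk₂ k (fun n m => TensorA.map k A (insertLeft hM n) LinearMap.id (M.pt.coact m))
      (fun n n' m => by
        have : insertLeft hM (n + n') = insertLeft hM n + insertLeft hM n' := by ext; simp
        rw [this, TensorA.map_add_left])
      (fun a n m => by
        have : insertLeft hM (a • n) = a • insertLeft hM n := by ext; simp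
        rw [this, TensorA.map_smul_left])
      (fun n m m' => by rw [map_add, map_add])
      (fun a n m => by
        rw [← map_smul]
        exact congrArg _ ((M.pt.coact.restrictScalars k).map_smul a m)))
    (fun n t m => by
      have : insertLeft hM (N.act n t) = insertLeft hM n ∘ₗ Comod.toLin (toEnd hM k t) :=
        LinearMap.ext fun m => BalTensor.tmul_balanced n t m
      rw [LinearMap.mk₂_apply, LinearMap.mk₂_apply, colimAct_apply, Comod.coact_toLin,
        TensorA.map_map, this]
      rfl)

@[simp] theorem tensorCoactAux_tmul (n : N.carrier) (m : M.pt.carrier) :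
    tensorCoactAux hM N (BalTensor.tmul N.act (colimAct hM) n m) =
      TensorA.map k A (insertLeft hM n) LinearMap.id (M.pt.coact m) :=
  BalTensor.lift_tmul _ _ _ _

/-- The coaction `n ⊗ m ↦ (n ⊗ m₀) ⊗ m₁` of `N ⊗_{T†} M`. -/
noncomputable def tensorCoact :
    BalTensor N.act (colimAct hM) →ₗ[Aᵐᵒᵖ] TensorA k A (BalTensor N.act (colimAct hM)) C where
  toFun := tensorCoactAux hM N
  map_add' := map_add _
  map_smul' a x := by
    induction x using BalTensor.induction_on with
    | zero => simp
    | tmul n m =>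
      rw [op_smul_balTensor_tmul, tensorCoactAux_tmul, tensorCoactAux_tmul, map_smul]
      exact (TensorA.mapRight k C (insertLeft hM n)).map_smul a _
    | add x y hx hy => simp only [smul_add, map_add, hx, hy]

@[simp] theorem tensorCoact_tmul (n : N.carrier) (m : M.pt.carrier) :
    tensorCoact hM N (BalTensor.tmul N.act (colimAct hM) n m) =
      TensorA.map k A (insertLeft hM n) LinearMap.id (M.pt.coact m) :=
  tensorCoactAux_tmul hM N n m

theorem tensorCoact_comp_insertLeft (n : N.carrier) :
    tensorCoact hM N ∘ₗ insertLeft hM n =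
      TensorA.mapRight k C (insertLeft hM n) ∘ₗ M.pt.coact :=
  LinearMap.ext fun m => tensorCoact_tmul hM N n m

/-- The `C`-comodule `N ⊗_{T†} M`. -/
noncomputable def tensorComod : Comod k A C where
  carrier := BalTensor N.act (colimAct hM)
  coact := tensorCoact hM N
  coassoc x := by
    induction x using BalTensor.induction_on with
    | zero => simp
    | add x y hx hy => simp only [map_add, hx, hy]
    | tmul n m =>
      have h := congrArg (TensorA.map k A (insertLeft hM n) LinearMap.id) (M.pt.coassoc m)
      rw [TensorA.map_map, ← TensorA.assoc_map, TensorA.map_map,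
        ← tensorCoact_comp_insertLeft] at h
      rw [tensorCoact_tmul, TensorA.map_map, TensorA.map_map]
      exact h
  coact_counit x := by
    induction x using BalTensor.induction_on with
    | zero => simp
    | add x y hx hy => simp only [map_add, hx, hy]
    | tmul n m => rw [tensorCoact_tmul, TensorA.contractRight_map, M.pt.coact_counit]; rfl

variable {N} in
/-- The map `M → N ⊗_{T†} M`, `m ↦ n ⊗ m`, as a morphism of comodules. -/
noncomputable def insertLeftHom (n : N.carrier) : M.pt ⟶ tensorComod hM N :=
  ⟨insertLeft hM n, fun m => tensorCoact_tmul hM N n m⟩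

end TensorComod

/-- A `k`-linear map `g : N ⊗_{T†} M → X` such that every `m ↦ g (n ⊗ m)` is colinear is a morphism
of comodules. -/
noncomputable def tensorComodDesc {N : RMod k (ColimEnd S k)} {X : Comod k A C}
    (g : BalTensor N.act (colimAct hM) →ₗ[k] X.carrier) (h : N.carrier → (M.pt ⟶ X))
    (hg : ∀ n m, g (BalTensor.tmul N.act (colimAct hM) n m) = Comod.toLin (h n) m) :
    tensorComod hM N ⟶ X :=
  let g' : BalTensor N.act (colimAct hM) →ₗ[Aᵐᵒᵖ] X.carrier :=
    { toFun := g
      map_add' := map_add g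
      map_smul' := fun a x => by
        induction x using BalTensor.induction_on with
        | zero => simp
        | tmul n m => rw [op_smul_balTensor_tmul, hg, hg, map_smul]; rfl
        | add x y hx hy => simp only [smul_add, map_add, hx, hy] }
  ⟨g', fun x => by
    change X.coact (g' x) = TensorA.map k A g' LinearMap.id (tensorCoact hM N x)
    induction x using BalTensor.induction_on with
    | zero => simp
    | add x y hx hy => simp only [map_add, hx, hy]
    | tmul n m =>
      have : g' ∘ₗ insertLeft hM n = Comod.toLin (h n) := LinearMap.ext (hg n)
      rw [tensorCoact_tmul, TensorA.map_map, this]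
      exact (congrArg X.coact (hg n m)).trans (Comod.coact_toLin (h n) m)⟩

theorem tensorComod_hom_ext {N : RMod k (ColimEnd S k)} {X : Comod k A C}
    {f g : tensorComod hM N ⟶ X}
    (h : ∀ n m, Comod.toLin f (BalTensor.tmul N.act (colimAct hM) n m) =
      Comod.toLin g (BalTensor.tmul N.act (colimAct hM) n m)) : f = g :=
  Comod.hom_ext fun x => by
    induction x using BalTensor.induction_on with
    | zero => exact (map_zero _).trans (map_zero _).symm
    | tmul n m => exact h n m
    | add x y hx hy => exact (map_add _ _ _).trans ((congrArg₂ _ hx hy).trans (map_add _ _ _).symm)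

/-- The map `f ⊗_{T†} M`, as a morphism of comodules. -/
noncomputable def tensorComodMap {N N' : RMod k (ColimEnd S k)} (f : N ⟶ N') :
    tensorComod hM N ⟶ tensorComod hM N' :=
  tensorComodDesc hM (RMod.tensorMap (colimAct hM) f)
    (fun n => insertLeftHom hM (RMod.toLin f n)) (fun _ _ => RMod.tensorMap_tmul _ _ _ _)

theorem toLin_tensorComodMap_tmul {N N' : RMod k (ColimEnd S k)} (f : N ⟶ N') (n : N.carrier)
    (m : M.pt.carrier) :
    Comod.toLin (tensorComodMap hM f) (BalTensor.tmul N.act (colimAct hM) n m) =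
      BalTensor.tmul N'.act (colimAct hM) (RMod.toLin f n) m :=
  RMod.tensorMap_tmul _ _ _ _

/-- The functor `- ⊗_{T†} M` from right `T†`-modules to right `C`-comodules. -/
noncomputable def tensorFunctor : RMod k (ColimEnd S k) ⥤ Comod k A C where
  obj N := tensorComod hM N
  map f := tensorComodMap hM f
  map_id N := tensorComod_hom_ext hM fun n m => toLin_tensorComodMap_tmul hM _ n m
  map_comp f g := tensorComod_hom_ext hM fun n m => by
    rw [toLin_tensorComodMap_tmul, Comod.toLin_comp]
    refine Eq.symm ((congrArg (Comod.toLin (tensorComodMap hM g))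
      (toLin_tensorComodMap_tmul hM f n m)).trans ?_)
    exact toLin_tensorComodMap_tmul hM g _ m

/-! ### The module of colinear maps and the evaluation -/

section Colinear

variable (X : Comod k A C)

/-- `Hom^C(M, X)†`: the colinear maps `f : M → X` with `f = f ∘ μ_i ∘ ν_i` for some `i`. -/
noncomputable def colinDagger : Submodule k (M.pt ⟶ X) where
  carrier := {f | ∃ i, (νc hM i ≫ μc M i) ≫ f = f}
  add_mem' := by
    have key {i l : I} (h : i ≤ l) (f : M.pt ⟶ X) (hf : (νc hM i ≫ μc M i) ≫ f = f) :
        (νc hM l ≫ μc M l) ≫ f = f := by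
      refine Comod.hom_ext fun m => ?_
      have hf' : Comod.toLin f ∘ₗ idem hM i = Comod.toLin f := congrArg Comod.toLin hf
      change (Comod.toLin f ∘ₗ idem hM l) m = _
      rw [← hf', LinearMap.comp_assoc, idem_comp hM h]
    rintro f g ⟨i, hi⟩ ⟨j, hj⟩
    obtain ⟨l, hil, hjl⟩ := exists_ge_ge i j
    refine ⟨l, ?_⟩
    rw [Preadditive.comp_add, key hil f hi, key hjl g hj]
  zero_mem' := ⟨Classical.arbitrary I, by simp⟩
  smul_mem' := by
    rintro a f ⟨i, hi⟩
    exact ⟨i, by rw [Linear.comp_smul, hi]⟩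

/-- `Hom^C(M, X)†` as a right `T†`-module, by precomposition. -/
noncomputable def colinDaggerMod : RMod k (ColimEnd S k) where
  carrier := colinDagger hM X
  act := LinearMap.mk₂ k
    (fun f t => ⟨toEnd hM k t ≫ f.1, by
      obtain ⟨i, hi⟩ := toLin_toEnd_comp_idem hM t
      exact ⟨i, Comod.hom_ext fun m =>
        congrArg (Comod.toLin f.1) (LinearMap.congr_fun hi m)⟩⟩)
    (fun f g t => Subtype.ext (Preadditive.comp_add _ _ _ _ _ _))
    (fun a f t => Subtype.ext (Linear.comp_smul _ _ _ _ _ _))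
    (fun f s t => Subtype.ext <|
      (congrArg (fun g : M.pt ⟶ M.pt => g ≫ f.1) (map_add (toEnd hM k) s t)).trans
        (Preadditive.add_comp _ _ _ _ _ _))
    (fun a f t => Subtype.ext <|
      (congrArg (fun g : M.pt ⟶ M.pt => g ≫ f.1) (map_smul (toEnd hM k) a t)).trans
        (Linear.smul_comp _ _ _ _ _ _))
  act_mul f s t := Subtype.ext <| by
    change toEnd hM k (s * t) ≫ f.1 = toEnd hM k t ≫ toEnd hM k s ≫ f.1
    rw [map_mul, End.mul_def, Category.assoc]

namespace colinDaggerMod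

variable {X}

/-- The colinear map underlying an element of `Hom^C(M, X)†`. -/
noncomputable def val : (colinDaggerMod hM X).carrier →ₗ[k] (M.pt ⟶ X) :=
  (colinDagger hM X).subtype

theorem val_injective : Function.Injective (val hM (X := X)) := Subtype.val_injective

theorem val_act (f : (colinDaggerMod hM X).carrier) (t : ColimEnd S k) :
    val hM ((colinDaggerMod hM X).act f t) = toEnd hM k t ≫ val hM f := rfl

theorem exists_idem (f : (colinDaggerMod hM X).carrier) :
    ∃ i, (νc hM i ≫ μc M i) ≫ val hM f = val hM f := f.2

end colinDaggerMod

open colinDaggerMod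

theorem toEnd_localUnit (i : I) : toEnd hM k (localUnit k S i) = νc hM i ≫ μc M i :=
  Comod.hom_ext fun m => LinearMap.congr_fun (toLin_toEnd_localUnit hM i) m

theorem isFirm_colinDaggerMod : RMod.IsFirm k (ColimEnd S k) (colinDaggerMod hM X) :=
  RMod.isFirm_of_exists mul_localUnit _ fun f => by
    obtain ⟨i, hi⟩ := exists_idem hM f
    refine ⟨i, val_injective hM ?_⟩
    rw [val_act, toEnd_localUnit, hi]

/-- The inclusion of `Hom^C(M, X)†` into `Hom_A(M, X)†`. -/
noncomputable def colinIncl : colinDaggerMod hM X ⟶ homDaggerMod hM X.carrier :=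
  RMod.Hom.mk
    (LinearMap.codRestrict (homDagger hM X.carrier)
      { toFun := fun f => Comod.toLin (val hM f)
        map_add' := fun f g => rfl
        map_smul' := fun a f => rfl }
      (fun f => by
        obtain ⟨i, hi⟩ := exists_idem hM f
        exact ⟨i, (congrArg Comod.toLin hi).symm⟩))
    (fun f t => rfl)

@[simp] theorem val_colinIncl (f : (colinDaggerMod hM X).carrier) :
    homDaggerMod.val hM (RMod.toLin (colinIncl hM X) f) = Comod.toLin (val hM f) := rfl

theorem colinIncl_injective : Function.Injective (RMod.toLin (colinIncl hM X)) := fun _ _ h =>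
  val_injective hM (Subtype.ext (congrArg (homDaggerMod.val hM) h))

/-- The morphism `Hom_A(M, X)† → Hom_A(M, X ⊗_A C)†` that sends `f` to
`ρ_X ∘ f - (f ⊗ C) ∘ ρ_M`; its kernel is `Hom^C(M, X)†`. -/
noncomputable def colinDefect :
    homDaggerMod hM X.carrier ⟶ homDaggerMod hM (TensorA k A X.carrier C) :=
  RMod.Hom.mk
    (LinearMap.codRestrict (homDagger hM (TensorA k A X.carrier C))
      { toFun := fun f => X.coact ∘ₗ homDaggerMod.val hM f -
          TensorA.mapRight k C (homDaggerMod.val hM f) ∘ₗ M.pt.coact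
        map_add' := fun f g => by
          ext m
          simp [TensorA.map_add_left]
          abel
        map_smul' := fun a f => by
          ext m
          have := (X.coact.restrictScalars k).map_smul a (homDaggerMod.val hM f m)
          simp only [LinearMap.restrictScalars_apply] at this
          simp [TensorA.map_smul_left, smul_sub, this] }
      (fun f => by
        obtain ⟨i, hi⟩ := homDaggerMod.exists_idem hM f
        refine ⟨i, ?_⟩
        -- `μ_i ∘ ν_i` is colinear, so `(f ⊗ C) ∘ ρ_M` is also fixed by it.
        have hρ : M.pt.coact ∘ₗ idem hM i = TensorA.mapRight k C (idem hM i) ∘ₗ M.pt.coact :=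
          LinearMap.ext fun m => Comod.coact_toLin (νc hM i ≫ μc M i) m
        have hf : TensorA.mapRight k C (homDaggerMod.val hM f) ∘ₗ
            TensorA.mapRight k C (idem hM i) = TensorA.mapRight k C (homDaggerMod.val hM f) :=
          LinearMap.ext fun y => by
            simp only [LinearMap.comp_apply, TensorA.mapRight_apply, TensorA.map_map, ← hi]
            rfl
        simp only [LinearMap.coe_mk, AddHom.coe_mk, LinearMap.sub_comp, LinearMap.comp_assoc,
          hρ, ← hi]
        rw [← LinearMap.comp_assoc M.pt.coact, hf]))
    (fun f t => homDaggerMod.ext hM fun m => by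
      have h := Comod.coact_toLin (toEnd hM k t) m
      change X.coact (homDaggerMod.val hM f (Comod.toLin (toEnd hM k t) m)) -
          TensorA.map k A (homDaggerMod.val hM f ∘ₗ Comod.toLin (toEnd hM k t)) LinearMap.id
            (M.pt.coact m) =
        X.coact (homDaggerMod.val hM f (Comod.toLin (toEnd hM k t) m)) -
          TensorA.map k A (homDaggerMod.val hM f) LinearMap.id
            (M.pt.coact (Comod.toLin (toEnd hM k t) m))
      rw [h, TensorA.map_map]
      rfl)

theorem val_colinDefect (f : (homDaggerMod hM X.carrier).carrier) :
    homDaggerMod.val hM (RMod.toLin (colinDefect hM X) f) =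
      X.coact ∘ₗ homDaggerMod.val hM f -
        TensorA.mapRight k C (homDaggerMod.val hM f) ∘ₗ M.pt.coact := rfl

theorem exact_colinIncl_colinDefect :
    Function.Exact (RMod.toLin (colinIncl hM X)) (RMod.toLin (colinDefect hM X)) := by
  intro f
  constructor
  · intro hf
    have h := congrArg (homDaggerMod.val hM) hf
    rw [val_colinDefect, map_zero] at h
    obtain ⟨i, hi⟩ := homDaggerMod.exists_idem hM f
    let g : M.pt ⟶ X := ⟨homDaggerMod.val hM f, fun m => sub_eq_zero.1 (LinearMap.congr_fun h m)⟩
    exact ⟨(⟨g, i, Comod.hom_ext fun m => (LinearMap.congr_fun hi m).symm⟩ : colinDagger hM X),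
      rfl⟩
  · rintro ⟨g, rfl⟩
    refine homDaggerMod.ext hM fun m => ?_
    rw [val_colinDefect, val_colinIncl, map_zero]
    exact sub_eq_zero.2 (Comod.coact_toLin (val hM g) m)

/-- The evaluation `Hom^C(M, X)† ⊗_{T†} M → X`, `f ⊗ m ↦ f m`, as a `k`-linear map. -/
noncomputable def evalLin : BalTensor (colinDaggerMod hM X).act (colimAct hM) →ₗ[k] X.carrier :=
  BalTensor.lift
    (LinearMap.mk₂ k (fun f m => Comod.toLin (val hM f) m)
      (fun _ _ _ => rfl) (fun _ _ _ => rfl) (fun _ _ _ => map_add _ _ _)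
      (fun a f m => ((Comod.toLin (val hM f)).restrictScalars k).map_smul a m))
    (fun _ _ _ => rfl)

@[simp] theorem evalLin_tmul (f : (colinDaggerMod hM X).carrier) (m : M.pt.carrier) :
    evalLin hM X (BalTensor.tmul _ _ f m) = Comod.toLin (val hM f) m :=
  BalTensor.lift_tmul _ _ _ _

/-- The evaluation `Hom^C(M, X)† ⊗_{T†} M → X`, `f ⊗ m ↦ f m`, as a morphism of comodules. -/
noncomputable def evalHom : tensorComod hM (colinDaggerMod hM X) ⟶ X :=
  tensorComodDesc hM (evalLin hM X) (val hM) (evalLin_tmul hM X)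

theorem coact_evalLin (z : BalTensor (colinDaggerMod hM X).act (colimAct hM)) :
    X.coact (evalLin hM X z) =
      canHom hM X.carrier (RMod.tensorMap (colimAct hM) (colinIncl hM X) z) := by
  induction z using BalTensor.induction_on with
  | zero => simp
  | tmul f m => simp [Comod.coact_toLin]
  | add z z' hz hz' => simp only [map_add, hz, hz']

/-- Under `canHom`, the map `colinDefect ⊗_{T†} M` becomes `ρ_X ⊗ C - X ⊗ Δ`. -/
theorem assoc_canHom_colinDefect (z : BalTensor (homDaggerMod hM X.carrier).act (colimAct hM)) :
    TensorA.assoc k A X.carrier C C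
        (canHom hM _ (RMod.tensorMap (colimAct hM) (colinDefect hM X) z)) =
      TensorA.assoc k A X.carrier C C
          (TensorA.map k A X.coact LinearMap.id (canHom hM X.carrier z)) -
        TensorA.map k A LinearMap.id (Coring.comul (k := k)) (canHom hM X.carrier z) := by
  induction z using BalTensor.induction_on with
  | zero => simp
  | add z z' hz hz' => simp only [map_add, hz, hz']; abel
  | tmul f m =>
    rw [RMod.tensorMap_tmul, canHom_tmul, canHom_tmul, val_colinDefect, TensorA.map_sub_left,
      map_sub, TensorA.map_map, TensorA.map_map]
    congr 1
    have h := congrArg (TensorA.map k A (homDaggerMod.val hM f) LinearMap.id) (M.pt.coassoc m)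
    rw [← TensorA.assoc_map, TensorA.map_map, TensorA.map_map] at h
    exact h

/-- The evaluation `Hom^C(M, X)† ⊗_{T†} M → X` is bijective: by flatness its source is the kernel
of `colinDefect ⊗_{T†} M`, hence through `canHom` the kernel of
`ρ_X ⊗ C - X ⊗ Δ : X ⊗_A C → X ⊗_A C ⊗_A C`, and `ρ_X` embeds `X` into that kernel. -/
theorem evalLin_bijective (hfin : ∀ i, Module.Finite Aᵐᵒᵖ (S.obj i).of.carrier)
    (hproj : ∀ i, Module.Projective Aᵐᵒᵖ (S.obj i).of.carrier)
    (hG : Function.Bijective (can hM)) (hflat : IsFlatAction (colimAct hM)) :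
    Function.Bijective (evalLin hM X) := by
  have hι := RMod.tensorMap_injective hflat _ (colinIncl_injective hM X)
  have hcan := canHom_bijective hM X.carrier hfin hproj hG
  have hcan' := canHom_bijective hM (TensorA k A X.carrier C) hfin hproj hG
  constructor
  · intro z z' h
    apply hι
    apply hcan.1
    rw [← coact_evalLin, ← coact_evalLin, h]
  · intro x
    obtain ⟨y, hy⟩ := hcan.2 (X.coact x)
    have h : RMod.tensorMap (colimAct hM) (colinDefect hM X) y = 0 := by
      apply hcan'.1
      apply TensorA.assoc_injective
      rw [assoc_canHom_colinDefect, hy, X.coassoc, sub_self, map_zero, map_zero]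
    obtain ⟨z, rfl⟩ := (hflat _ _ (exact_colinIncl_colinDefect hM X) y).1 h
    exact ⟨z, X.coact_injective (by rw [coact_evalLin, hy])⟩

end Colinear

/-! ### The unit and the equivalence -/

section Unit

open colinDaggerMod

variable {N N' : RMod k (ColimEnd S k)} (hN : RMod.IsFirm k (ColimEnd S k) N)
  (hN' : RMod.IsFirm k (ColimEnd S k) N')

/-- The unit `N → Hom^C(M, N ⊗_{T†} M)†`, `n ↦ (m ↦ n ⊗ m)`, for a firm module `N`. -/
noncomputable def unitHom : N ⟶ colinDaggerMod hM (tensorComod hM N) :=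
  RMod.Hom.mk
    (LinearMap.codRestrict (colinDagger hM (tensorComod hM N))
      { toFun := insertLeftHom hM
        map_add' := fun n n' => Comod.hom_ext fun m =>
          LinearMap.congr_fun (map_add (BalTensor.tmul N.act (colimAct hM)) n n') m
        map_smul' := fun a n => Comod.hom_ext fun m =>
          LinearMap.congr_fun (map_smul (BalTensor.tmul N.act (colimAct hM)) a n) m }
      (fun n => by
        obtain ⟨i, hi⟩ := RMod.exists_of_isFirm mul_localUnit N hN n
        refine ⟨i, Comod.hom_ext fun m => ?_⟩
        have h := BalTensor.tmul_balanced (r := N.act) (l := colimAct hM) n (localUnit k S i) m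
        rw [hi i le_rfl, colimAct_apply, toEnd_localUnit] at h
        exact h.symm))
    (fun n t => val_injective hM <| Comod.hom_ext fun m => BalTensor.tmul_balanced n t m)

theorem val_unitHom (n : N.carrier) :
    val hM (RMod.toLin (unitHom hM hN) n) = insertLeftHom hM n := rfl

theorem evalLin_tensorMap_unitHom (z : BalTensor N.act (colimAct hM)) :
    evalLin hM (tensorComod hM N) (RMod.tensorMap (colimAct hM) (unitHom hM hN) z) = z := by
  induction z using BalTensor.induction_on with
  | zero => exact (congrArg _ (map_zero _)).trans (map_zero _)
  | tmul n m =>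
    rw [RMod.tensorMap_tmul, evalLin_tmul, val_unitHom]
    rfl
  | add z z' hz hz' =>
    rw [map_add, map_add, hz, hz']
    rfl

theorem unitHom_bijective (hff : IsFaithfullyFlatAction (colimAct hM))
    (hev : Function.Bijective (evalLin hM (tensorComod hM N))) :
    Function.Bijective (RMod.toLin (unitHom hM hN)) :=
  RMod.bijective_of_tensorMap_bijective hff hN (isFirm_colinDaggerMod hM _) _
    ⟨Function.LeftInverse.injective (g := evalLin hM (tensorComod hM N))
        (evalLin_tensorMap_unitHom hM hN),
      fun y => ⟨evalLin hM _ y, hev.1 (evalLin_tensorMap_unitHom hM hN _)⟩⟩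

/-- The morphism `Hom^C(M, X)† → Hom^C(M, Y)†` of postcomposition with `g`. -/
noncomputable def colinDaggerMap {X Y : Comod k A C} (g : X ⟶ Y) :
    colinDaggerMod hM X ⟶ colinDaggerMod hM Y :=
  RMod.Hom.mk
    (LinearMap.codRestrict (colinDagger hM Y)
      { toFun := fun f => val hM f ≫ g
        map_add' := fun f f' => by rw [map_add, Preadditive.add_comp]
        map_smul' := fun a f => by rw [map_smul, Linear.smul_comp]; rfl }
      (fun f => by
        obtain ⟨i, hi⟩ := exists_idem hM f
        exact ⟨i, by
          change (νc hM i ≫ μc M i) ≫ val hM f ≫ g = val hM f ≫ g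
          rw [← Category.assoc, hi]⟩))
    (fun f t => val_injective hM (Category.assoc (toEnd hM k t) (val hM f) g))

end Unit

end Galois

theorem theorem7p4 {k : Type v} [CommRing k] {A : Type u} [Ring A] [Algebra k A]
    {C : Type u} [AddCommGroup C] [Module k C] [Module A C] [Module Aᵐᵒᵖ C]
    [IsScalarTower k A C] [IsScalarTower k Aᵐᵒᵖ C] [SMulCommClass A Aᵐᵒᵖ C] [Coring k A C]
    {I : Type u} [PartialOrder I] [IsDirectedOrder I] [Nonempty I]
    (S : I ⥤ SplitCat (Comod k A C))
    (hfin : ∀ i, Module.Finite Aᵐᵒᵖ (S.obj i).of.carrier)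
    (hproj : ∀ i, Module.Projective Aᵐᵒᵖ (S.obj i).of.carrier)
    (M : Cocone (S ⋙ SplitCat.forget (Comod k A C))) (hM : IsColimit M)
    (hGalois : Function.Bijective (can hM))
    (hff : IsFaithfullyFlatAction (colimAct hM)) :
    Nonempty (FirmMod k (SplitSystem.ColimEnd S k) ≌ Comod k A C) := by
  have hev (X : Comod k A C) : Function.Bijective (evalLin hM X) :=
    evalLin_bijective hM X hfin hproj hGalois hff.1
  have hη (N : FirmMod k (SplitSystem.ColimEnd S k)) :
      Function.Bijective (RMod.toLin (unitHom hM N.property)) :=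
    unitHom_bijective hM N.property hff (hev _)
  let F : FirmMod k (SplitSystem.ColimEnd S k) ⥤ Comod k A C :=
    (RMod.IsFirm k (SplitSystem.ColimEnd S k)).ι ⋙ tensorFunctor hM
  have : F.Faithful := ⟨fun {N N' f g} h => by
    refine ObjectProperty.hom_ext _ (RMod.hom_ext fun n => ?_)
    apply (hη N').1
    refine colinDaggerMod.val_injective hM (Comod.hom_ext fun m => ?_)
    have h' := congrArg (fun φ => Comod.toLin φ (BalTensor.tmul N.obj.act (colimAct hM) n m)) h
    exact (toLin_tensorComodMap_tmul hM f.hom n m).symm.trans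
      (h'.trans (toLin_tensorComodMap_tmul hM g.hom n m))⟩
  have : F.Full := ⟨fun {N N'} g => by
    -- `Hom^C(M, g)†`, transported along the units of `N` and `N'`.
    let f : N.obj ⟶ N'.obj :=
      unitHom hM N.property ≫ colinDaggerMap hM g ≫ RMod.invHom _ (hη N')
    refine ⟨ObjectProperty.homMk f, tensorComod_hom_ext hM fun n m => ?_⟩
    have hf : RMod.toLin (unitHom hM N'.property) (RMod.toLin f n) =
        RMod.toLin (colinDaggerMap hM g) (RMod.toLin (unitHom hM N.property) n) :=
      RMod.toLin_invHom _ (hη N') _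
    have hf' := congrArg (fun φ => Comod.toLin (colinDaggerMod.val hM φ) m) hf
    exact (toLin_tensorComodMap_tmul hM f n m).trans hf'⟩
  have : F.EssSurj := ⟨fun X => by
    have := Comod.isIso_of_bijective (evalHom hM X) (hev X)
    let e : tensorComod hM (colinDaggerMod hM X) ≅ X := asIso (evalHom hM X)
    exact ⟨⟨colinDaggerMod hM X, isFirm_colinDaggerMod hM X⟩, ⟨e⟩⟩⟩
  have : F.IsEquivalence := {}
  exact ⟨F.asEquivalence⟩
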